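/- Let $m\ge 1$, $j\in\{1,\dots,m\}$, $\beta_0\in\mathbb R^m$, $c\in\mathbb R$, $0<\tau<\infty$, let $\lambda\ge 0$ be a baseline hazard rate and $\Lambda(t)=\int_0^t\lambda(u)\,du$. For every $n$ let failure times $T_i$, censoring times $C_i$ (in $[0,\infty]$) and covariates $z^{(i)}\in\mathbb R^m$, $i=1,\dots,n$, be random variables on a probability space (depending on $n$). Put $X_i=T_i\wedge C_i$, $\delta_i=\mathbf 1\{T_i\le C_i\}$, $N_i(t)=\mathbf 1\{X_i\le t,\delta_i=1\}$, $Y_i(t)=\mathbf 1\{X_i\ge t\}$ and $$S^{(k)}(t,\beta)=\sum_{i=1}^n (z^{(i)})^{\otimes k}\,Y_i(t)e^{\beta^Tz^{(i)}}\ (k=0,1,2),\qquad E=\frac{S^{(1)}}{S^{(0)}},\qquad \dot\ell(\beta)=\sum_{i=1}^n\int_0^\tau\{z^{(i)}-E(u,\beta)\}\,dN_i(u),$$ where $x^{\otimes 0}=1$, $x^{\otimes 1}=x$, $x^{\otimes 2}=xx^T$. Assume the local alternative $\gamma_j=c/\sqrt n$: on $[0,\tau]$, given $z^{(i)}$, the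 time $T_i$ has hazard rate $\lambda_i(t)=g(z^{(i)},\Lambda(t),\beta_0,c/\sqrt n)\,\lambda(t)$, where $$g(z,L,\beta,\gamma)=\frac{\exp\{\beta^Tz+Le^{\gamma z_j}\}}{1+e^{\gamma z_j}\,[\exp\{Le^{\gamma z_j}\}-1]},$$ and the compensator of $N_i$ on $[0,\tau]$, with respect to the history generated by all $z^{(k)}$, $N_k$, $Y_k$, is $\int_0^tY_i(u)\lambda_i(u)\,du$. Assume moreover: a) for each $n$, the triples $(X_i,\delta_i,z^{(i)})$, $i=1,\dots,n$, are i.i.d.; b) $\sup\{t\ge 0:\sum_{i=1}^nY_i(t)>0\}\to\tau$ in probability; c) $\|z^{(i)}\|\le K$ almost surely, for a constant $K$ that does not depend on $i$ and $n$; d) $\Lambda(\tau)<\infty$; e) with $s^{(k)}=\mathbf E S^{(k)}/n$ and $v=s^{(2)}/s^{(0)}-(s^{(1)}/s^{(0)})^{\otimes 2}$ (these depend on $n$; quotients with zero denominator are $0$), the matrix $\Sigma(\beta_0)=\int_0^\tau v(u,\beta_0)\,s^{(0)}(u,\beta_0)\,d\Lambda(u)$ is positive definite, non-degenerately in $n$: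 there is a positive definite matrix $A$, not depending on $n$, such that $\Sigma(\beta_0)-A$ is positive semidefinite for all large $n$. (If $\Sigma(\beta_0)$ converges as $n\to\infty$, this says that its limit is positive definite.) Then, as $n\to\infty$, the probability that the equation $\dot\ell(\beta)=0$ has a unique solution $\beta\in\mathbb R^m$ tends to $1$. Moreover, if $\hat\beta$ almost surely equals this solution whenever a unique solution exists (and is arbitrary otherwise), then $\hat\beta\to\beta_0$ in probability. -/

import Mathlib

open MeasureTheory ProbabilityTheory Filter Topology
open scoped ENNReal

/-- Right censored failure time regression data for `n` units with `m` covariates: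
failure times `T i`, censoring times `C i` (both in `[0, ∞]`) and covariate vectors `z i`. -/
structure SurvivalSample (m n : ℕ) (Ω : Type*) [MeasurableSpace Ω] where
  T : Fin n → Ω → ℝ≥0∞
  C : Fin n → Ω → ℝ≥0∞
  z : Fin n → Ω → EuclideanSpace ℝ (Fin m)
  measurable_T : ∀ i, Measurable (T i)
  measurable_C : ∀ i, Measurable (C i)
  measurable_z : ∀ i, Measurable (z i)

/-- The baseline cumulative hazard `Λ(t) = ∫₀ᵗ λ(u) du`. -/
noncomputable def cumHazard (lam : ℝ → ℝ) (t : ℝ) : ℝ := ∫ u in (0 : ℝ)..t, lam u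

/-- The factor `g(z, Λ, β, γ_j)` of the alternative model. -/
noncomputable def hazardFactor {m : ℕ} (j : Fin m) (z : EuclideanSpace ℝ (Fin m)) (L : ℝ)
    (β : EuclideanSpace ℝ (Fin m)) (γ : ℝ) : ℝ :=
  Real.exp (inner ℝ β z + L * Real.exp (γ * z j)) /
    (1 + Real.exp (γ * z j) * (Real.exp (L * Real.exp (γ * z j)) - 1))

/-- The conditional hazard rate `λ(t | z) = g(z, Λ(t), β, γ_j) λ(t)`. -/
noncomputable def hazardRate {m : ℕ} (lam : ℝ → ℝ) (j : Fin m)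
    (β : EuclideanSpace ℝ (Fin m)) (γ : ℝ) (t : ℝ) (z : EuclideanSpace ℝ (Fin m)) : ℝ :=
  hazardFactor j z (cumHazard lam t) β γ * lam t

namespace SurvivalSample

variable {m n : ℕ} {Ω : Type*} [mΩ : MeasurableSpace Ω]

/-- The observation time `X_i = T_i ∧ C_i`. -/
noncomputable def X (D : SurvivalSample m n Ω) (i : Fin n) (ω : Ω) : ℝ≥0∞ :=
  min (D.T i ω) (D.C i ω)

/-- The failure indicator `δ_i = 1{T_i ≤ C_i}`. -/
noncomputable def δ (D : SurvivalSample m n Ω) (i : Fin n) : Ω → ℝ :=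
  Set.indicator {ω | D.T i ω ≤ D.C i ω} 1

/-- The observation `(X_i, δ_i, z⁽ⁱ⁾)` of the `i`-th unit. -/
noncomputable def obs (D : SurvivalSample m n Ω) (i : Fin n) (ω : Ω) :
    ℝ≥0∞ × ℝ × EuclideanSpace ℝ (Fin m) :=
  (D.X i ω, D.δ i ω, D.z i ω)

/-- The counting process `N_i(t) = 1{X_i ≤ t, δ_i = 1}`. -/
noncomputable def N (D : SurvivalSample m n Ω) (i : Fin n) (t : ℝ) : Ω → ℝ :=
  Set.indicator {ω | D.X i ω ≤ ENNReal.ofReal t ∧ D.δ i ω = 1} 1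

/-- The at-risk process `Y_i(t) = 1{X_i ≥ t}`. -/
noncomputable def Y (D : SurvivalSample m n Ω) (i : Fin n) (t : ℝ) : Ω → ℝ :=
  Set.indicator {ω | ENNReal.ofReal t ≤ D.X i ω} 1

/-- The random time `sup {t ≥ 0 : Y(t) > 0}`, where `Y = ∑ Y_i`. -/
noncomputable def lastAtRisk (D : SurvivalSample m n Ω) (ω : Ω) : ℝ≥0∞ :=
  sSup {s | ∃ t : ℝ, 0 ≤ t ∧ 0 < ∑ i, D.Y i t ω ∧ s = ENNReal.ofReal t}

theorem measurable_X (D : SurvivalSample m n Ω) (i : Fin n) : Measurable (D.X i) :=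
  (D.measurable_T i).min (D.measurable_C i)

theorem measurable_δ (D : SurvivalSample m n Ω) (i : Fin n) : Measurable (D.δ i) :=
  measurable_one.indicator (measurableSet_le (D.measurable_T i) (D.measurable_C i))

theorem measurable_N (D : SurvivalSample m n Ω) (i : Fin n) (t : ℝ) : Measurable (D.N i t) :=
  measurable_one.indicator
    ((measurableSet_le (D.measurable_X i) measurable_const).inter
      ((D.measurable_δ i) (measurableSet_singleton 1)))

theorem measurable_Y (D : SurvivalSample m n Ω) (i : Fin n) (t : ℝ) : Measurable (D.Y i t) :=
  measurable_one.indicator (measurableSet_le measurable_const (D.measurable_X i))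

/-- The history of the observed data on `[0, τ]`: at time `t` it is generated by all covariates
and by the processes `N_i(s)`, `Y_i(s)` for `s ≤ t`. -/
noncomputable def history (D : SurvivalSample m n Ω) (τ : ℝ) :
    Filtration (Set.Icc (0 : ℝ) τ) mΩ where
  seq t := ⨆ i : Fin n, (MeasurableSpace.comap (D.z i) inferInstance ⊔
    ⨆ s : Set.Icc (0 : ℝ) τ, ⨆ _ : s ≤ t,
      (MeasurableSpace.comap (D.N i s) inferInstance ⊔
        MeasurableSpace.comap (D.Y i s) inferInstance))
  mono' _ _ h := iSup_mono fun _ => sup_le_sup le_rfl <|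
    iSup_mono fun _ => iSup_mono' fun hs => ⟨hs.trans h, le_rfl⟩
  le' _ := iSup_le fun i => sup_le (D.measurable_z i).comap_le <|
    iSup_le fun s => iSup_le fun _ =>
      sup_le (D.measurable_N i s).comap_le (D.measurable_Y i s).comap_le

/-- The observations `(X_i, δ_i, z⁽ⁱ⁾)` are independent and identically distributed. -/
def IsIID (D : SurvivalSample m n Ω) (P : Measure Ω) : Prop :=
  iIndepFun D.obs P ∧ ∀ i k, IdentDistrib (D.obs i) (D.obs k) P P

/-- On `[0, τ]`, given `z⁽ⁱ⁾`, the failure time `T_i` has an absolutely continuous distribution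
with hazard rate `h(· | z⁽ⁱ⁾)`:
`P(T_i > t | z⁽ⁱ⁾) = exp (-∫₀ᵗ h(u | z⁽ⁱ⁾) du)` almost surely. -/
def HasHazard (D : SurvivalSample m n Ω) (P : Measure Ω) (τ : ℝ)
    (h : ℝ → EuclideanSpace ℝ (Fin m) → ℝ) : Prop :=
  ∀ i, ∀ t ∈ Set.Icc (0 : ℝ) τ,
    P[Set.indicator {ω | ENNReal.ofReal t < D.T i ω} (fun _ => (1 : ℝ)) |
        MeasurableSpace.comap (D.z i) inferInstance]
      =ᵐ[P] fun ω => Real.exp (-∫ u in (0 : ℝ)..t, h u (D.z i ω))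

/-- The multiplicative intensities model on `[0, τ]`: the compensator of `N_i` with respect to
the history of the observed data is `∫₀ᵗ Y_i(u) h(u | z⁽ⁱ⁾) du`. -/
def HasIntensity (D : SurvivalSample m n Ω) (P : Measure Ω) (τ : ℝ)
    (h : ℝ → EuclideanSpace ℝ (Fin m) → ℝ) : Prop :=
  ∀ i, Martingale
    (fun (t : Set.Icc (0 : ℝ) τ) ω =>
      D.N i t ω - ∫ u in (0 : ℝ)..t, D.Y i u ω * h u (D.z i ω))
    (D.history τ) P

/-- `S⁽⁰⁾(t, β) = ∑ Y_i(t) exp(βᵀz⁽ⁱ⁾)`. -/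
noncomputable def S0 (D : SurvivalSample m n Ω) (t : ℝ) (β : EuclideanSpace ℝ (Fin m))
    (ω : Ω) : ℝ :=
  ∑ i, D.Y i t ω * Real.exp (inner ℝ β (D.z i ω))

/-- `S⁽¹⁾(t, β) = ∑ z⁽ⁱ⁾ Y_i(t) exp(βᵀz⁽ⁱ⁾)`. -/
noncomputable def S1 (D : SurvivalSample m n Ω) (t : ℝ) (β : EuclideanSpace ℝ (Fin m))
    (ω : Ω) : EuclideanSpace ℝ (Fin m) :=
  ∑ i, (D.Y i t ω * Real.exp (inner ℝ β (D.z i ω))) • D.z i ω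

/-- `S⁽²⁾(t, β) = ∑ z⁽ⁱ⁾(z⁽ⁱ⁾)ᵀ Y_i(t) exp(βᵀz⁽ⁱ⁾)`. -/
noncomputable def S2 (D : SurvivalSample m n Ω) (t : ℝ) (β : EuclideanSpace ℝ (Fin m))
    (ω : Ω) : Matrix (Fin m) (Fin m) ℝ :=
  Matrix.of fun a b =>
    ∑ i, D.z i ω a * D.z i ω b * (D.Y i t ω * Real.exp (inner ℝ β (D.z i ω)))

/-- `E(t, β) = S⁽¹⁾(t, β) / S⁽⁰⁾(t, β)`. -/
noncomputable def E (D : SurvivalSample m n Ω) (t : ℝ) (β : EuclideanSpace ℝ (Fin m))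
    (ω : Ω) : EuclideanSpace ℝ (Fin m) :=
  (D.S0 t β ω)⁻¹ • D.S1 t β ω

/-- The Cox partial likelihood score `ℓ̇(t, β) = ∑ᵢ ∫₀ᵗ {z⁽ⁱ⁾ - E(u, β)} dN_i(u)`.
The path of `N_i` has at most one jump, which is of size one and occurs at `X_i` if `δ_i = 1`;
so the `i`-th integral is `N_i(t) {z⁽ⁱ⁾ - E(X_i, β)}`. -/
noncomputable def score (D : SurvivalSample m n Ω) (t : ℝ) (β : EuclideanSpace ℝ (Fin m))
    (ω : Ω) : EuclideanSpace ℝ (Fin m) :=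
  ∑ i, D.N i t ω • (D.z i ω - D.E (D.X i ω).toReal β ω)

/-- `s⁽⁰⁾(t, β) = E S⁽⁰⁾(t, β) / n`. -/
noncomputable def s0 (D : SurvivalSample m n Ω) (P : Measure Ω) (t : ℝ)
    (β : EuclideanSpace ℝ (Fin m)) : ℝ :=
  (∫ ω, D.S0 t β ω ∂P) / n

/-- `s⁽¹⁾(t, β) = E S⁽¹⁾(t, β) / n`. -/
noncomputable def s1 (D : SurvivalSample m n Ω) (P : Measure Ω) (t : ℝ)
    (β : EuclideanSpace ℝ (Fin m)) : EuclideanSpace ℝ (Fin m) :=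
  (n : ℝ)⁻¹ • ∫ ω, D.S1 t β ω ∂P

/-- `s⁽²⁾(t, β) = E S⁽²⁾(t, β) / n`, entry by entry. -/
noncomputable def s2 (D : SurvivalSample m n Ω) (P : Measure Ω) (t : ℝ)
    (β : EuclideanSpace ℝ (Fin m)) : Matrix (Fin m) (Fin m) ℝ :=
  Matrix.of fun a b => (∫ ω, D.S2 t β ω a b ∂P) / n

/-- `e(t, β) = s⁽¹⁾(t, β) / s⁽⁰⁾(t, β)`. -/
noncomputable def e (D : SurvivalSample m n Ω) (P : Measure Ω) (t : ℝ)
    (β : EuclideanSpace ℝ (Fin m)) : EuclideanSpace ℝ (Fin m) :=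
  (D.s0 P t β)⁻¹ • D.s1 P t β

/-- `v(t, β) = s⁽²⁾(t, β) / s⁽⁰⁾(t, β) - e(t, β) e(t, β)ᵀ`. -/
noncomputable def v (D : SurvivalSample m n Ω) (P : Measure Ω) (t : ℝ)
    (β : EuclideanSpace ℝ (Fin m)) : Matrix (Fin m) (Fin m) ℝ :=
  Matrix.of fun a b => D.s2 P t β a b / D.s0 P t β - D.e P t β a * D.e P t β b

/-- `Σ(β) = ∫₀^τ v(u, β) s⁽⁰⁾(u, β) dΛ(u)`, entry by entry. -/
noncomputable def infoMatrix (D : SurvivalSample m n Ω) (P : Measure Ω) (lam : ℝ → ℝ) (τ : ℝ)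
    (β : EuclideanSpace ℝ (Fin m)) : Matrix (Fin m) (Fin m) ℝ :=
  Matrix.of fun a b => ∫ u in (0 : ℝ)..τ, D.v P u β a b * D.s0 P u β * lam u

end SurvivalSample

/-! The score is the gradient of the concave log partial likelihood, so two facts at the single
point `β₀` suffice: the score there is o(n) in probability, and the estimated information there is
bounded below by a multiple of n.

The deterministic half makes concavity quantitative. Moving the parameter from β to β + h tilts the
weights of each risk set exponentially, and this raises the mean of ⟨h, z⟩ by at least a positive
constant times its variance at `β₀` (`variance_le_tilted_mean_sub_mean`). The information at `β₀`
thus controls the score at every β. A small score and a large information at `β₀` force a zero in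
the ε-ball, unique in the whole space (`exists_unique_tiltedScore_eq_zero`). Neither a Taylor
expansion nor convergence uniform in β is needed.

The probabilistic half bounds errors in L¹. The martingale property identifies the law of (z, X) on
an observed failure: it is the image of the density Y g with respect to P ⊗ dΛ
(`map_restrict_failureEvent`). Uniformly in Λ(t), g differs from exp(β₀ᵀz) by a relative error of at
most exp(|γ|K) - 1, which tends to 0 for γ = c/√n; the local alternative therefore costs only o(n).
Sums over failures of non-random functions of (z, X) concentrate by independence
(`lintegral_abs_sum_N_mul_sub_le`).

The averages over the risk set at X_i are random and depend on unit i. With unit i deleted, the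
centered risk sums are O(√n) given X_i. Passing to ratios divides by s⁽⁰⁾, which may be arbitrarily
small, but the total failure intensity is of order n s⁽⁰⁾ and cancels it
(`lintegral_sum_abs_riskRatio_sub_le`). Markov's inequality turns the L¹ bounds into probabilities.
-/

section Tilting

/-! ### Exponential tilting and the deterministic root-finding argument -/

theorem sum_sum_mul_sub_mul_sub {ι : Type*} [Fintype ι] (p x t : ι → ℝ) :
    ∑ k, ∑ l, p k * p l * ((x k - x l) * (t k - t l)) =
      2 * ((∑ k, p k) * (∑ k, p k * (x k * t k)) - (∑ k, p k * x k) * (∑ k, p k * t k)) := by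
  have h : ∀ k l, p k * p l * ((x k - x l) * (t k - t l)) =
      (p k * (x k * t k)) * p l - (p k * x k) * (p l * t l)
        - (p k * t k) * (p l * x l) + p k * (p l * (x l * t l)) := fun k l => by ring
  simp only [h, Finset.sum_add_distrib, Finset.sum_sub_distrib, ← Finset.mul_sum, ← Finset.sum_mul]
  ring

/-- Strong monotonicity: on [-b, b] the derivative of exp is at least exp(-b). -/
theorem exp_neg_mul_sq_le {b x y : ℝ} (hx : |x| ≤ b) (hy : |y| ≤ b) :
    Real.exp (-b) * ((x - y) * (x - y)) ≤ (x - y) * (Real.exp x - Real.exp y) := by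
  wlog h : y ≤ x generalizing x y
  · have := this hy hx (le_of_not_ge h)
    linarith [this]
  have h1 : Real.exp (-b) * (x - y) ≤ Real.exp x - Real.exp y := by
    have e1 : Real.exp x = Real.exp y * Real.exp (x - y) := by rw [← Real.exp_add]; ring_nf
    have e2 : x - y + 1 ≤ Real.exp (x - y) := Real.add_one_le_exp _
    have e3 : Real.exp (-b) ≤ Real.exp y := Real.exp_le_exp.2 (neg_le_of_abs_le hy)
    calc Real.exp (-b) * (x - y) ≤ Real.exp y * (x - y) :=
          mul_le_mul_of_nonneg_right e3 (sub_nonneg.2 h)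
      _ ≤ Real.exp y * (Real.exp (x - y) - 1) :=
          mul_le_mul_of_nonneg_left (by linarith) (Real.exp_pos _).le
      _ = _ := by rw [e1]; ring
  calc _ = (x - y) * (Real.exp (-b) * (x - y)) := by ring
    _ ≤ _ := mul_le_mul_of_nonneg_left h1 (sub_nonneg.2 h)

/-- Exponential tilting increases a weighted mean by at least a multiple of the variance. -/
theorem variance_le_tilted_mean_sub_mean {ι : Type*} [Fintype ι] {p w x : ι → ℝ} {b d : ℝ}
    (hw : ∀ k, 0 ≤ w k) (hpw : ∀ k, Real.exp (-d) * w k ≤ p k)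
    (hwp : ∀ k, p k ≤ Real.exp d * w k) (hx : ∀ k, |x k| ≤ b) (hW : 0 < ∑ k, w k) :
    Real.exp (-(4 * d + 2 * b)) *
        ((∑ k, w k * x k ^ 2) / (∑ k, w k) - ((∑ k, w k * x k) / ∑ k, w k) ^ 2) ≤
      (∑ k, p k * Real.exp (x k) * x k) / (∑ k, p k * Real.exp (x k)) -
        (∑ k, p k * x k) / ∑ k, p k := by
  set W := ∑ k, w k with hWdef
  set A := ∑ k, p k * Real.exp (x k) with hA
  set B := ∑ k, p k with hB
  have hp : ∀ k, 0 ≤ p k := fun k => (mul_nonneg (Real.exp_pos _).le (hw k)).trans (hpw k)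
  have hBpos : 0 < B := by
    have : Real.exp (-d) * W ≤ B := by
      rw [hWdef, Finset.mul_sum]; exact Finset.sum_le_sum fun k _ => hpw k
    exact (mul_pos (Real.exp_pos _) hW).trans_le this
  have hBle : B ≤ Real.exp d * W := by
    rw [hWdef, Finset.mul_sum]; exact Finset.sum_le_sum fun k _ => hwp k
  have hAB : Real.exp (-b) * B ≤ A := by
    rw [hB, Finset.mul_sum]
    refine Finset.sum_le_sum fun k _ => ?_
    rw [mul_comm]
    exact mul_le_mul_of_nonneg_left (Real.exp_le_exp.2 (neg_le_of_abs_le (hx k))) (hp k)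
  have hBA : A ≤ Real.exp b * B := by
    rw [hB, Finset.mul_sum]
    refine Finset.sum_le_sum fun k _ => ?_
    rw [mul_comm]
    exact mul_le_mul_of_nonneg_right (Real.exp_le_exp.2 (le_of_abs_le (hx k))) (hp k)
  have hApos : 0 < A := (mul_pos (Real.exp_pos _) hBpos).trans_le hAB
  have hABle : A * B ≤ Real.exp (2 * d + b) * W ^ 2 := by
    calc A * B ≤ (Real.exp b * B) * B := mul_le_mul_of_nonneg_right hBA hBpos.le
      _ = Real.exp b * (B * B) := by ring
      _ ≤ Real.exp b * ((Real.exp d * W) * (Real.exp d * W)) := by gcongr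
      _ = _ := by
        rw [show 2 * d + b = b + (d + d) by ring, Real.exp_add, Real.exp_add]; ring
  -- By `sum_sum_mul_sub_mul_sub`, the difference of means and the variance are both double sums
  -- over pairs, which can be compared term by term. This comparison loses 2d + b in the exponent;
  -- replacing A B by W² loses another 2d + b, hence 4d + 2b.
  set N₁ := ∑ k, ∑ l, p k * p l * ((x k - x l) * (Real.exp (x k) - Real.exp (x l))) with hN₁
  set N₂ := ∑ k, ∑ l, w k * w l * ((x k - x l) * (x k - x l)) with hN₂
  have hN₂0 : 0 ≤ N₂ := Finset.sum_nonneg fun k _ => Finset.sum_nonneg fun l _ =>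
    mul_nonneg (mul_nonneg (hw k) (hw l)) (mul_self_nonneg _)
  have hN : Real.exp (-(2 * d + b)) * N₂ ≤ N₁ := by
    rw [hN₂, hN₁, Finset.mul_sum]
    refine Finset.sum_le_sum fun k _ => ?_
    rw [Finset.mul_sum]
    refine Finset.sum_le_sum fun l _ => ?_
    calc Real.exp (-(2 * d + b)) * (w k * w l * ((x k - x l) * (x k - x l)))
        = (Real.exp (-d) * w k) * (Real.exp (-d) * w l) *
          (Real.exp (-b) * ((x k - x l) * (x k - x l))) := by
          rw [show -(2 * d + b) = -d + -d + -b by ring, Real.exp_add, Real.exp_add]; ring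
      _ ≤ p k * p l * ((x k - x l) * (Real.exp (x k) - Real.exp (x l))) := by
          refine mul_le_mul (mul_le_mul (hpw k) (hpw l) ?_ (hp k)) (exp_neg_mul_sq_le (hx k) (hx l))
            ?_ (mul_nonneg (hp k) (hp l))
          · exact mul_nonneg (Real.exp_pos _).le (hw l)
          · exact mul_nonneg (Real.exp_pos _).le (mul_self_nonneg _)
  have e₁ : (∑ k, p k * Real.exp (x k) * x k) / A - (∑ k, p k * x k) / B = N₁ / (2 * (A * B)) := by
    rw [hN₁, sum_sum_mul_sub_mul_sub, ← hB, ← hA]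
    have : ∑ k, p k * Real.exp (x k) * x k = ∑ k, p k * (x k * Real.exp (x k)) :=
      Finset.sum_congr rfl fun k _ => by ring
    rw [this]
    field_simp
  have e₂ : (∑ k, w k * x k ^ 2) / W - ((∑ k, w k * x k) / W) ^ 2 = N₂ / (2 * W ^ 2) := by
    rw [hN₂, sum_sum_mul_sub_mul_sub, ← hWdef]
    have : ∑ k, w k * x k ^ 2 = ∑ k, w k * (x k * x k) :=
      Finset.sum_congr rfl fun k _ => by ring
    rw [this]
    field_simp
  rw [e₁, e₂, le_div_iff₀ (by positivity)]
  have hexp : Real.exp (-(4 * d + 2 * b)) * Real.exp (2 * d + b) = Real.exp (-(2 * d + b)) := by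
    rw [← Real.exp_add]; congr 1; ring
  calc Real.exp (-(4 * d + 2 * b)) * (N₂ / (2 * W ^ 2)) * (2 * (A * B))
      = Real.exp (-(4 * d + 2 * b)) * N₂ * (A * B) / W ^ 2 := by field_simp
    _ ≤ Real.exp (-(4 * d + 2 * b)) * N₂ * (Real.exp (2 * d + b) * W ^ 2) / W ^ 2 := by gcongr
    _ = Real.exp (-(4 * d + 2 * b)) * Real.exp (2 * d + b) * N₂ := by field_simp
    _ ≤ N₁ := by rw [hexp]; exact hN

variable {ι : Type*} [Fintype ι] {V : Type*} [NormedAddCommGroup V] [InnerProductSpace ℝ V]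

/-- The total mass of the weights `y k` after exponential tilting by `β`. -/
noncomputable def tiltedMass (y : ι → ℝ) (z : ι → V) (β : V) : ℝ :=
  ∑ k, y k * Real.exp (inner ℝ β (z k))

/-- The mean of the points `z k` under the exponentially tilted weights. -/
noncomputable def tiltedMean (y : ι → ℝ) (z : ι → V) (β : V) : V :=
  (tiltedMass y z β)⁻¹ • ∑ k, (y k * Real.exp (inner ℝ β (z k))) • z k

/-- The variance of `⟪h, z k⟫` under the exponentially tilted weights. -/
noncomputable def tiltedVariance (y : ι → ℝ) (z : ι → V) (β h : V) : ℝ :=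
  (∑ k, y k * Real.exp (inner ℝ β (z k)) * inner ℝ h (z k) ^ 2) / tiltedMass y z β -
    inner ℝ h (tiltedMean y z β) ^ 2

/-- The score built from risk sets with weights `y i` and event weights `N i`. -/
noncomputable def tiltedScore (N : ι → ℝ) (y : ι → ι → ℝ) (z : ι → V) (β : V) : V :=
  ∑ i, N i • (z i - tiltedMean (y i) z β)

theorem inner_tiltedMean (y : ι → ℝ) (z : ι → V) (β h : V) :
    inner ℝ h (tiltedMean y z β) =
      (∑ k, y k * Real.exp (inner ℝ β (z k)) * inner ℝ h (z k)) / tiltedMass y z β := by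
  simp only [tiltedMean, inner_smul_right, inner_sum]
  ring

theorem tiltedMass_pos {y : ι → ℝ} (hy : ∀ k, 0 ≤ y k) (hpos : ∃ k, 0 < y k) (z : ι → V) (β : V) :
    0 < tiltedMass y z β := by
  obtain ⟨k, hk⟩ := hpos
  exact Finset.sum_pos' (fun l _ => mul_nonneg (hy l) (Real.exp_pos _).le)
    ⟨k, Finset.mem_univ _, mul_pos hk (Real.exp_pos _)⟩

/-- The weights at β and at `β₀` differ by factors within exp(±‖β - β₀‖K), so the variance at the
fixed point `β₀` can serve for every β. -/
theorem tiltedVariance_le_inner_tiltedMean_sub {y : ι → ℝ} (hy : ∀ k, 0 ≤ y k)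
    (hpos : ∃ k, 0 < y k) {z : ι → V} {K : ℝ} (hz : ∀ k, ‖z k‖ ≤ K) (β₀ β h : V) :
    Real.exp (-(4 * (‖β - β₀‖ * K) + 2 * (‖h‖ * K))) * tiltedVariance y z β₀ h ≤
      inner ℝ h (tiltedMean y z (β + h) - tiltedMean y z β) := by
  have hb : ∀ v k, |inner ℝ v (z k)| ≤ ‖v‖ * K := fun v k =>
    (abs_real_inner_le_norm v (z k)).trans (mul_le_mul_of_nonneg_left (hz k) (norm_nonneg v))
  have key := variance_le_tilted_mean_sub_mean
    (p := fun k => y k * Real.exp (inner ℝ β (z k)))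
    (w := fun k => y k * Real.exp (inner ℝ β₀ (z k)))
    (x := fun k => inner ℝ h (z k)) (b := ‖h‖ * K) (d := ‖β - β₀‖ * K)
    (fun k => mul_nonneg (hy k) (Real.exp_pos _).le)
    (fun k => by
      rw [mul_left_comm, ← Real.exp_add]
      refine mul_le_mul_of_nonneg_left (Real.exp_le_exp.2 ?_) (hy k)
      have := neg_le_of_abs_le (hb (β - β₀) k)
      rw [inner_sub_left] at this
      linarith)
    (fun k => by
      rw [mul_left_comm, ← Real.exp_add]
      refine mul_le_mul_of_nonneg_left (Real.exp_le_exp.2 ?_) (hy k)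
      have := le_of_abs_le (hb (β - β₀) k)
      rw [inner_sub_left] at this
      linarith)
    (hb h) (tiltedMass_pos hy hpos z β₀)
  rw [inner_sub_right, inner_tiltedMean, inner_tiltedMean, tiltedVariance, inner_tiltedMean]
  convert key using 3 <;> simp only [tiltedMass, inner_add_left, Real.exp_add, mul_assoc]

/-- Monotonicity of the score along h, with a modulus given by the information at `β₀` alone.
Nonempty risk sets matter only where an event occurs, since the other terms carry the weight 0. -/
theorem inner_tiltedScore_sub_le {N : ι → ℝ} {y : ι → ι → ℝ} (hN : ∀ i, 0 ≤ N i)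
    (hy : ∀ i k, 0 ≤ y i k) (hpos : ∀ i, N i ≠ 0 → ∃ k, 0 < y i k) {z : ι → V} {K : ℝ}
    (hz : ∀ k, ‖z k‖ ≤ K) (β₀ β h : V) :
    inner ℝ h (tiltedScore N y z (β + h)) ≤ inner ℝ h (tiltedScore N y z β) -
      Real.exp (-(4 * (‖β - β₀‖ * K) + 2 * (‖h‖ * K))) *
        ∑ i, N i * tiltedVariance (y i) z β₀ h := by
  simp only [tiltedScore, inner_sum, inner_smul_right, Finset.mul_sum]
  rw [← Finset.sum_sub_distrib]
  refine Finset.sum_le_sum fun i _ => ?_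
  by_cases hi : N i = 0
  · simp [hi]
  · have := mul_le_mul_of_nonneg_left (tiltedVariance_le_inner_tiltedMean_sub (hy i) (hpos i hi) hz
      β₀ β h) (hN i)
    rw [inner_sub_right] at this ⊢
    rw [inner_sub_right]
    linarith

theorem hasFDerivAt_tiltedMass (y : ι → ℝ) (z : ι → V) (β : V) :
    HasFDerivAt (tiltedMass y z)
      (innerSL ℝ (∑ k, (y k * Real.exp (inner ℝ β (z k))) • z k)) β := by
  have h : ∀ k ∈ Finset.univ, HasFDerivAt (fun β => y k * Real.exp (inner ℝ β (z k)))
      (innerSL ℝ ((y k * Real.exp (inner ℝ β (z k))) • z k)) β := fun k _ => by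
    have h1 : HasFDerivAt (fun β : V => inner ℝ β (z k)) (innerSL ℝ (z k)) β := by
      have := (innerSL ℝ (z k)).hasFDerivAt (x := β)
      refine this.congr_of_eventuallyEq (Eventually.of_forall fun x => ?_)
      simp [real_inner_comm]
    have h2 := (h1.exp).const_mul (y k)
    refine h2.congr_fderiv ?_
    rw [map_smul, smul_smul]
  refine (HasFDerivAt.fun_sum h).congr_fderiv ?_
  rw [map_sum]

/-- Exhibits the score as a gradient, so that a zero can be obtained by maximization over a compact
ball. -/
theorem hasFDerivAt_logPartialLikelihood {N : ι → ℝ} {y : ι → ι → ℝ}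
    (hy : ∀ i k, 0 ≤ y i k) (hpos : ∀ i, N i ≠ 0 → ∃ k, 0 < y i k) (z : ι → V) (β : V) :
    HasFDerivAt (fun β => ∑ i, N i * (inner ℝ β (z i) - Real.log (tiltedMass (y i) z β)))
      (innerSL ℝ (tiltedScore N y z β)) β := by
  have h : ∀ i ∈ Finset.univ,
      HasFDerivAt (fun β => N i * (inner ℝ β (z i) - Real.log (tiltedMass (y i) z β)))
        (innerSL ℝ (N i • (z i - tiltedMean (y i) z β))) β := fun i _ => by
    by_cases hi : N i = 0
    · simp only [hi, zero_mul, zero_smul, map_zero]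
      exact hasFDerivAt_const _ _
    · have h1 : HasFDerivAt (fun β : V => inner ℝ β (z i)) (innerSL ℝ (z i)) β := by
        have := (innerSL ℝ (z i)).hasFDerivAt (x := β)
        refine this.congr_of_eventuallyEq (Eventually.of_forall fun x => ?_)
        simp [real_inner_comm]
      have h2 := (hasFDerivAt_tiltedMass (y i) z β).log (tiltedMass_pos (hy i) (hpos i hi) z β).ne'
      have h3 := (h1.sub h2).const_mul (N i)
      refine h3.congr_fderiv ?_
      rw [tiltedMean, map_smul, map_sub, map_smul]
  refine (HasFDerivAt.fun_sum h).congr_fderiv ?_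
  rw [tiltedScore, map_sum]

/-- If the information at `β₀` is positive definite and the score at `β₀` is small relative to it,
then the score has a unique zero, and the zero is close to `β₀`. -/
theorem exists_unique_tiltedScore_eq_zero [ProperSpace V] {N : ι → ℝ} {y : ι → ι → ℝ}
    (hN : ∀ i, 0 ≤ N i) (hy : ∀ i k, 0 ≤ y i k) (hpos : ∀ i, N i ≠ 0 → ∃ k, 0 < y i k)
    {z : ι → V} {K : ℝ} (hz : ∀ k, ‖z k‖ ≤ K) {β₀ : V} {ε a : ℝ} (hε : 0 < ε) (ha : 0 < a)
    (hinfo : ∀ h, a * ‖h‖ ^ 2 ≤ ∑ i, N i * tiltedVariance (y i) z β₀ h)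
    (hscore : ‖tiltedScore N y z β₀‖ < Real.exp (-(2 * (ε * K))) * (a * ε)) :
    ∃ β, ‖β - β₀‖ < ε ∧ tiltedScore N y z β = 0 ∧
      ∀ β', tiltedScore N y z β' = 0 → β' = β := by
  -- On the sphere of radius ε the loss exp(-2εK) a ε² exceeds ε times the norm of the score at
  -- `β₀`, so the score points inward.
  have hbdry : ∀ h : V, ‖h‖ = ε → inner ℝ h (tiltedScore N y z (β₀ + h)) < 0 := fun h hh => by
    have h1 := inner_tiltedScore_sub_le hN hy hpos hz β₀ β₀ h
    have h2 : inner ℝ h (tiltedScore N y z β₀) ≤ ε * ‖tiltedScore N y z β₀‖ := by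
      rw [← hh]; exact real_inner_le_norm _ _
    have h3 := mul_le_mul_of_nonneg_left (hinfo h) (Real.exp_pos (-(2 * (ε * K)))).le
    have h4 := mul_lt_mul_of_pos_left hscore hε
    simp only [sub_self, norm_zero, zero_mul, mul_zero, zero_add, hh] at h1 h3
    nlinarith
  set f : V → ℝ := fun β => ∑ i, N i * (inner ℝ β (z i) - Real.log (tiltedMass (y i) z β)) with hf
  have hfd : ∀ β, HasFDerivAt f (innerSL ℝ (tiltedScore N y z β)) β :=
    hasFDerivAt_logPartialLikelihood hy hpos z
  obtain ⟨β, hβ, hmax⟩ := (isCompact_closedBall β₀ ε).exists_isMaxOn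
    ⟨β₀, Metric.mem_closedBall_self hε.le⟩
    (fun β _ => (hfd β).continuousAt.continuousWithinAt : ContinuousOn f (Metric.closedBall β₀ ε))
  -- At a maximizer on the boundary the derivative towards the centre would be nonpositive, against
  -- `hbdry`.
  have hlt : ‖β - β₀‖ < ε := by
    refine lt_of_le_of_ne (by simpa [dist_eq_norm] using hβ) fun heq => ?_
    have h1 := hbdry (β - β₀) heq
    have hseg : segment ℝ β β₀ ⊆ Metric.closedBall β₀ ε :=
      (convex_closedBall β₀ ε).segment_subset hβ (Metric.mem_closedBall_self hε.le)
    have h2 := IsLocalMaxOn.hasFDerivWithinAt_nonpos hmax.localize (hfd β).hasFDerivWithinAt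
      (sub_mem_posTangentConeAt_of_segment_subset hseg)
    rw [add_sub_cancel] at h1
    rw [innerSL_apply_apply, real_inner_comm] at h2
    rw [← neg_sub, inner_neg_left] at h1
    linarith
  have hzero : tiltedScore N y z β = 0 := by
    have hloc : IsLocalMax f β := hmax.isLocalMax
      (Filter.mem_of_superset (Metric.isOpen_ball.mem_nhds
        (by simpa [dist_eq_norm] using hlt : β ∈ Metric.ball β₀ ε)) Metric.ball_subset_closedBall)
    have := hloc.hasFDerivAt_eq_zero (hfd β)
    have h2 := congrArg (fun L : V →L[ℝ] ℝ => L (tiltedScore N y z β)) this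
    simpa using h2
  refine ⟨β, hlt, hzero, fun β' hβ' => ?_⟩
  by_contra hne
  -- Between two zeros the score does not change, while the information at `β₀` forces a strict
  -- decrease. The distance of the zeros is not restricted, so uniqueness is global.
  have h1 := inner_tiltedScore_sub_le hN hy hpos hz β₀ β (β' - β)
  rw [add_sub_cancel, hβ', hzero, inner_zero_right, zero_sub] at h1
  have h2 : 0 < a * ‖β' - β‖ ^ 2 := by
    have : 0 < ‖β' - β‖ := norm_pos_iff.2 (sub_ne_zero.2 hne)
    positivity
  have h3 := mul_pos (Real.exp_pos (-(4 * (‖β - β₀‖ * K) + 2 * (‖β' - β‖ * K))))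
    (h2.trans_le (hinfo (β' - β)))
  linarith

end Tilting

/-! ### The alternative hazard as a perturbation of proportional hazards -/

section Hazard

theorem one_le_hazardFactor_denom {L θ : ℝ} (hL : 0 ≤ L) (hθ : 0 < θ) :
    1 ≤ 1 + θ * (Real.exp (L * θ) - 1) := by
  have : 0 ≤ Real.exp (L * θ) - 1 := sub_nonneg.2 (Real.one_le_exp (mul_nonneg hL hθ.le))
  nlinarith

/-- With θ = exp(γ z_j) and x = exp(Lθ) - 1, the relative error is (1 - θ)x / (1 + θx), and x / (1 +
θx) ≤ 1/θ whatever L is. The bound is therefore uniform in time. -/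
theorem abs_hazardFactor_sub_le {m : ℕ} (j : Fin m) (z : EuclideanSpace ℝ (Fin m)) {L : ℝ}
    (hL : 0 ≤ L) (β : EuclideanSpace ℝ (Fin m)) (γ : ℝ) :
    |hazardFactor j z L β γ - Real.exp (inner ℝ β z)| ≤
      Real.exp (inner ℝ β z) * |Real.exp (-(γ * z j)) - 1| := by
  have hθ := Real.exp_pos (γ * z j)
  set θ := Real.exp (γ * z j) with hθdef
  have hd := one_le_hazardFactor_denom hL hθ
  have hx : 0 ≤ Real.exp (L * θ) - 1 := sub_nonneg.2 (Real.one_le_exp (mul_nonneg hL hθ.le))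
  set x := Real.exp (L * θ) - 1 with hxdef
  have h1 : hazardFactor j z L β γ - Real.exp (inner ℝ β z) =
      Real.exp (inner ℝ β z) * ((1 - θ) * x / (1 + θ * x)) := by
    rw [hazardFactor, Real.exp_add, ← hθdef, ← hxdef, show Real.exp (L * θ) = 1 + x by rw [hxdef]; ring]
    field_simp
    ring
  rw [h1, abs_mul, Real.abs_exp]
  refine mul_le_mul_of_nonneg_left ?_ (Real.exp_pos _).le
  rw [abs_div, abs_mul, abs_of_nonneg hx, abs_of_pos (by linarith : 0 < 1 + θ * x),
    Real.exp_neg, ← hθdef, show θ⁻¹ - 1 = (1 - θ) / θ by field_simp, abs_div, abs_of_pos hθ,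
    div_le_div_iff₀ (by linarith) hθ]
  nlinarith [abs_nonneg (1 - θ), mul_nonneg hθ.le hx]

theorem hazardFactor_nonneg {m : ℕ} (j : Fin m) (z : EuclideanSpace ℝ (Fin m)) {L : ℝ}
    (hL : 0 ≤ L) (β : EuclideanSpace ℝ (Fin m)) (γ : ℝ) : 0 ≤ hazardFactor j z L β γ :=
  div_nonneg (Real.exp_pos _).le
    (zero_le_one.trans (one_le_hazardFactor_denom hL (Real.exp_pos _)))

/-- For the lower side, 1 - exp x ≤ 1 - exp(-y) ≤ exp y - 1, the last step because exp y + exp(-y) ≥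
2. -/
theorem abs_exp_sub_one_le_exp_sub_one {x y : ℝ} (h : |x| ≤ y) :
    |Real.exp x - 1| ≤ Real.exp y - 1 := by
  have h1 := Real.exp_le_exp.2 (le_of_abs_le h)
  have h2 := Real.exp_le_exp.2 (neg_le_of_abs_le h)
  have h3 : 2 ≤ Real.exp y + Real.exp (-y) := by
    have := Real.exp_pos y
    rw [Real.exp_neg]
    have h4 : Real.exp y * (Real.exp y)⁻¹ = 1 := mul_inv_cancel₀ this.ne'
    nlinarith [sq_nonneg (Real.exp y - 1), inv_pos.2 this]
  rw [abs_le]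
  constructor <;> linarith

theorem abs_hazardFactor_sub_le_of_norm_le {m : ℕ} (j : Fin m) {z : EuclideanSpace ℝ (Fin m)}
    {K : ℝ} (hz : ‖z‖ ≤ K) {L : ℝ} (hL : 0 ≤ L) (β : EuclideanSpace ℝ (Fin m)) (γ : ℝ) :
    |hazardFactor j z L β γ - Real.exp (inner ℝ β z)| ≤
      (Real.exp (|γ| * K) - 1) * Real.exp (inner ℝ β z) := by
  refine (abs_hazardFactor_sub_le j z hL β γ).trans ?_
  rw [mul_comm]
  refine mul_le_mul_of_nonneg_right (abs_exp_sub_one_le_exp_sub_one ?_) (Real.exp_pos _).le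
  rw [abs_neg, abs_mul]
  refine mul_le_mul_of_nonneg_left ?_ (abs_nonneg γ)
  exact (PiLp.norm_apply_le z j).trans hz

theorem AEMeasurable.hazardFactor {α : Type*} [MeasurableSpace α] {μ : Measure α} {m : ℕ}
    {f : α → EuclideanSpace ℝ (Fin m)} {g : α → ℝ} (hf : AEMeasurable f μ) (hg : AEMeasurable g μ)
    (j : Fin m) (β : EuclideanSpace ℝ (Fin m)) (γ : ℝ) :
    AEMeasurable (fun x => _root_.hazardFactor j (f x) (g x) β γ) μ := by
  unfold _root_.hazardFactor
  fun_prop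

/-- The measure `dΛ` on `(0, τ]`. -/
noncomputable def hazardMeasure (lam : ℝ → ℝ) (τ : ℝ) : Measure ℝ :=
  (volume.restrict (Set.Ioc 0 τ)).withDensity fun u => ENNReal.ofReal (lam u)

variable {lam : ℝ → ℝ} {τ : ℝ}

theorem isFiniteMeasure_hazardMeasure (hτ : 0 ≤ τ) (hΛ : IntervalIntegrable lam volume 0 τ) :
    IsFiniteMeasure (hazardMeasure lam τ) :=
  isFiniteMeasure_withDensity_ofReal
    ((intervalIntegrable_iff_integrableOn_Ioc_of_le hτ).1 hΛ).2

theorem cumHazard_nonneg (hlam : ∀ t, 0 ≤ lam t) {t : ℝ} (ht : 0 ≤ t) : 0 ≤ cumHazard lam t :=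
  intervalIntegral.integral_nonneg ht fun u _ => hlam u

theorem aemeasurable_cumHazard (hτ : 0 ≤ τ) (hΛ : IntervalIntegrable lam volume 0 τ) :
    AEMeasurable (cumHazard lam) (volume.restrict (Set.Ioc 0 τ)) := by
  have h : ContinuousOn (cumHazard lam) (Set.uIcc 0 τ) :=
    intervalIntegral.continuousOn_primitive_interval
      ((intervalIntegrable_iff_integrableOn_Icc_of_le hτ).1 hΛ |>.mono_set
        (by rw [Set.uIcc_of_le hτ]))
  rw [Set.uIcc_of_le hτ] at h
  exact (h.mono Set.Ioc_subset_Icc_self).aemeasurable measurableSet_Ioc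

theorem ae_hazardMeasure_cumHazard_nonneg (hlam : ∀ t, 0 ≤ lam t) :
    ∀ᵐ u ∂(hazardMeasure lam τ), 0 ≤ cumHazard lam u :=
  (withDensity_absolutelyContinuous _ _).ae_le <|
    (ae_restrict_mem measurableSet_Ioc).mono fun _ hu => cumHazard_nonneg hlam hu.1.le

end Hazard

/-! ### The law of an observed failure -/

namespace SurvivalSample

variable {m n : ℕ} {Ω : Type*} [mΩ : MeasurableSpace Ω] (D : SurvivalSample m n Ω)

theorem Y_nonneg (i : Fin n) (t : ℝ) (ω : Ω) : 0 ≤ D.Y i t ω :=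
  Set.indicator_nonneg (fun _ _ => zero_le_one) _

theorem Y_le_one (i : Fin n) (t : ℝ) (ω : Ω) : D.Y i t ω ≤ 1 :=
  Set.indicator_le' (fun _ _ => le_rfl) (fun _ _ => zero_le_one) _

theorem N_nonneg (i : Fin n) (t : ℝ) (ω : Ω) : 0 ≤ D.N i t ω :=
  Set.indicator_nonneg (fun _ _ => zero_le_one) _

theorem N_le_one (i : Fin n) (t : ℝ) (ω : Ω) : D.N i t ω ≤ 1 :=
  Set.indicator_le' (fun _ _ => le_rfl) (fun _ _ => zero_le_one) _

theorem measurable_Y_prod (i : Fin n) : Measurable fun p : Ω × ℝ => D.Y i p.2 p.1 := by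
  have : MeasurableSet {p : Ω × ℝ | ENNReal.ofReal p.2 ≤ D.X i p.1} :=
    measurableSet_le (ENNReal.measurable_ofReal.comp measurable_snd)
      ((D.measurable_X i).comp measurable_fst)
  exact measurable_one.indicator this

theorem measurable_Y_path (i : Fin n) (ω : Ω) : Measurable fun u => D.Y i u ω :=
  (D.measurable_Y_prod i).comp measurable_prodMk_left

/-- The failure intensity per unit of `dΛ`. -/
noncomputable def relativeIntensity (lam : ℝ → ℝ) (j : Fin m) (β : EuclideanSpace ℝ (Fin m))
    (γ : ℝ) (i : Fin n) (p : Ω × ℝ) : ℝ :=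
  D.Y i p.2 p.1 * hazardFactor j (D.z i p.1) (cumHazard lam p.2) β γ

theorem aemeasurable_relativeIntensity (P : Measure Ω) {lam : ℝ → ℝ} {τ : ℝ} (hτ : 0 ≤ τ)
    (hΛ : IntervalIntegrable lam volume 0 τ) (j : Fin m) (β : EuclideanSpace ℝ (Fin m)) (γ : ℝ)
    (i : Fin n) : AEMeasurable (D.relativeIntensity lam j β γ i) (P.prod (hazardMeasure lam τ)) := by
  have := isFiniteMeasure_hazardMeasure hτ hΛ
  have h1 : AEMeasurable (cumHazard lam) (hazardMeasure lam τ) :=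
    (aemeasurable_cumHazard hτ hΛ).mono_ac (withDensity_absolutelyContinuous _ _)
  exact (D.measurable_Y_prod i).aemeasurable.mul
    (((D.measurable_z i).comp measurable_fst).aemeasurable.hazardFactor h1.comp_snd j β γ)

variable {P : Measure Ω} [IsProbabilityMeasure P] {lam : ℝ → ℝ} {τ : ℝ}
  {h : ℝ → EuclideanSpace ℝ (Fin m) → ℝ}

/-- The hazard condition at t = 0 says that T is almost surely positive. This excludes an atom at
time 0, which the martingale increments cannot see and which dΛ on (0, τ] does not charge. -/
theorem ae_N_zero_eq_zero (hτ : 0 < τ) (hH : D.HasHazard P τ h) (i : Fin n) :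
    ∀ᵐ ω ∂P, D.N i 0 ω = 0 := by
  have h0 := hH i 0 ⟨le_rfl, hτ.le⟩
  simp only [intervalIntegral.integral_same, neg_zero, Real.exp_zero, ENNReal.ofReal_zero] at h0
  have hmeas : MeasurableSet {ω | 0 < D.T i ω} := measurableSet_lt measurable_const (D.measurable_T i)
  have h1 := integral_condExp (μ := P) (f := Set.indicator {ω | 0 < D.T i ω} fun _ => (1 : ℝ))
    (D.measurable_z i).comap_le
  rw [integral_congr_ae h0, integral_indicator_const _ hmeas] at h1
  have h2 : P {ω | 0 < D.T i ω} = 1 := by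
    have : P.real {ω | 0 < D.T i ω} = 1 := by simpa using h1.symm
    rwa [measureReal_def, ENNReal.toReal_eq_one_iff] at this
  have h3 : ∀ᵐ ω ∂P, 0 < D.T i ω := (prob_compl_eq_zero_iff hmeas).2 h2
  filter_upwards [h3] with ω hω
  refine Set.indicator_of_notMem (fun hN => ?_) _
  obtain ⟨hX, hδ⟩ := hN
  have hTC : D.T i ω ≤ D.C i ω := by
    by_contra hc
    have hδ' : D.δ i ω = 0 := Set.indicator_of_notMem (s := {ω | D.T i ω ≤ D.C i ω}) hc _
    exact zero_ne_one (hδ'.symm.trans hδ)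
  rw [X, min_eq_left hTC, ENNReal.ofReal_zero] at hX
  exact absurd hω (not_lt.2 hX)

theorem N_sub_N_eq_indicator (i : Fin n) {s t : ℝ} (hst : s ≤ t) (ω : Ω) :
    D.N i t ω - D.N i s ω =
      Set.indicator {ω | ENNReal.ofReal s < D.X i ω ∧ D.X i ω ≤ ENNReal.ofReal t ∧ D.δ i ω = 1}
        (fun _ => (1 : ℝ)) ω := by
  have hle := ENNReal.ofReal_le_ofReal hst
  simp only [N, Set.indicator_apply, Set.mem_ofPred_eq, Pi.one_apply]
  by_cases h1 : D.X i ω ≤ ENNReal.ofReal s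
  · have h2 := h1.trans hle
    simp [h1, h2, not_lt.2 h1]
  · simp [h1, not_le.1 h1]

theorem integrableOn_Y_mul_hazardRate (hτ : 0 ≤ τ) (hlam : ∀ t, 0 ≤ lam t)
    (hΛ : IntervalIntegrable lam volume 0 τ) (j : Fin m) (β : EuclideanSpace ℝ (Fin m)) (γ : ℝ)
    (i : Fin n) (ω : Ω) :
    IntegrableOn (fun u => D.Y i u ω * hazardRate lam j β γ u (D.z i ω)) (Set.Ioc 0 τ) := by
  have hl := (intervalIntegrable_iff_integrableOn_Ioc_of_le hτ).1 hΛ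
  have hm : AEStronglyMeasurable
      (fun u => D.Y i u ω * hazardFactor j (D.z i ω) (cumHazard lam u) β γ)
      (volume.restrict (Set.Ioc 0 τ)) := by
    refine AEMeasurable.aestronglyMeasurable (AEMeasurable.mul ?_ ?_)
    · exact (D.measurable_Y_path i ω).aemeasurable
    · exact aemeasurable_const.hazardFactor (aemeasurable_cumHazard hτ hΛ) j β γ
  have hb : ∀ᵐ u ∂volume.restrict (Set.Ioc 0 τ),
      ‖D.Y i u ω * hazardFactor j (D.z i ω) (cumHazard lam u) β γ‖ ≤
        Real.exp (|γ| * ‖D.z i ω‖) * Real.exp (inner ℝ β (D.z i ω)) := by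
    filter_upwards [ae_restrict_mem measurableSet_Ioc] with u hu
    have hL := cumHazard_nonneg hlam hu.1.le
    have h1 := le_of_abs_le (abs_hazardFactor_sub_le_of_norm_le j (le_refl ‖D.z i ω‖) hL β γ)
    have h2 := hazardFactor_nonneg j (D.z i ω) hL β γ
    rw [norm_mul, Real.norm_of_nonneg (D.Y_nonneg i u ω), Real.norm_of_nonneg h2]
    calc _ ≤ 1 * hazardFactor j (D.z i ω) (cumHazard lam u) β γ :=
          mul_le_mul_of_nonneg_right (D.Y_le_one i u ω) h2
      _ ≤ _ := by linarith
  have := hl.bdd_mul hm hb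
  simp only [mul_assoc] at this
  exact this

theorem lintegral_relativeIntensity (hτ : 0 ≤ τ) (hlam : ∀ t, 0 ≤ lam t)
    (hΛ : IntervalIntegrable lam volume 0 τ) (j : Fin m) (β : EuclideanSpace ℝ (Fin m)) (γ : ℝ)
    (i : Fin n) {a b : ℝ} (ha : 0 ≤ a) (hab : a ≤ b) (hb : b ≤ τ) (ω : Ω) :
    ∫⁻ u in Set.Ioc a b, ENNReal.ofReal (D.relativeIntensity lam j β γ i (ω, u))
        ∂(hazardMeasure lam τ) =
      ENNReal.ofReal (∫ u in a..b, D.Y i u ω * hazardRate lam j β γ u (D.z i ω)) := by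
  have hsub : Set.Ioc a b ⊆ Set.Ioc 0 τ := Set.Ioc_subset_Ioc ha hb
  have hl := (intervalIntegrable_iff_integrableOn_Ioc_of_le hτ).1 hΛ
  rw [hazardMeasure, restrict_withDensity measurableSet_Ioc, Measure.restrict_restrict measurableSet_Ioc,
    Set.inter_eq_left.2 hsub, lintegral_withDensity_eq_lintegral_mul₀'
      (hl.mono_set hsub).aemeasurable.ennreal_ofReal,
    intervalIntegral.integral_of_le hab, ofReal_integral_eq_lintegral_ofReal
      ((D.integrableOn_Y_mul_hazardRate hτ hlam hΛ j β γ i ω).mono_set hsub)]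
  · refine lintegral_congr fun u => ?_
    rw [Pi.mul_apply, ← ENNReal.ofReal_mul (hlam u), relativeIntensity, hazardRate]
    congr 1; ring
  · filter_upwards [ae_restrict_mem measurableSet_Ioc] with u hu
    exact mul_nonneg (D.Y_nonneg i u ω) (mul_nonneg
      (hazardFactor_nonneg j _ (cumHazard_nonneg hlam (ha.trans hu.1.le)) β γ) (hlam u))
  · have h1 : AEMeasurable (cumHazard lam) (volume.restrict (Set.Ioc a b)) :=
      (aemeasurable_cumHazard hτ hΛ).mono_measure (Measure.restrict_mono_set _ hsub)
    have h2 : AEMeasurable (fun u => hazardFactor j (D.z i ω) (cumHazard lam u) β γ)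
      (volume.restrict (Set.Ioc a b)) := aemeasurable_const.hazardFactor h1 j β γ
    exact (((D.measurable_Y_path i ω).aemeasurable.mul h2).ennreal_ofReal).mono_ac
      (withDensity_absolutelyContinuous _ _)

/-- The event z_i ∈ s lies in the history at time a, so the martingale has the same integral over it
at a and at b. The increments of N_i and of its compensator hence have equal integrals there. -/
theorem measure_failure_eq_lintegral (hτ : 0 ≤ τ) (hlam : ∀ t, 0 ≤ lam t)
    (hΛ : IntervalIntegrable lam volume 0 τ) {j : Fin m} {β : EuclideanSpace ℝ (Fin m)} {γ : ℝ}
    (hI : D.HasIntensity P τ (hazardRate lam j β γ)) (i : Fin n)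
    {s : Set (EuclideanSpace ℝ (Fin m))} (hs : MeasurableSet s)
    {a b : ℝ} (ha : 0 ≤ a) (hab : a ≤ b) (hb : b ≤ τ) :
    P ({ω | ENNReal.ofReal a < D.X i ω ∧ D.X i ω ≤ ENNReal.ofReal b ∧ D.δ i ω = 1} ∩
        D.z i ⁻¹' s) =
      ∫⁻ ω in D.z i ⁻¹' s,
        ENNReal.ofReal (∫ u in a..b, D.Y i u ω * hazardRate lam j β γ u (D.z i ω)) ∂P := by
  have hA : MeasurableSet (D.z i ⁻¹' s) := D.measurable_z i hs
  have hF : MeasurableSet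
      {ω | ENNReal.ofReal a < D.X i ω ∧ D.X i ω ≤ ENNReal.ofReal b ∧ D.δ i ω = 1} :=
    (measurableSet_lt measurable_const (D.measurable_X i)).inter
      ((measurableSet_le (D.measurable_X i) measurable_const).inter
        ((D.measurable_δ i) (measurableSet_singleton 1)))
  set C : ℝ → Ω → ℝ := fun t ω => ∫ u in (0 : ℝ)..t, D.Y i u ω * hazardRate lam j β γ u (D.z i ω)
    with hC
  have hN : ∀ t, Integrable (D.N i t) P := fun t =>
    Integrable.of_bound (D.measurable_N i t).aestronglyMeasurable 1
      (Eventually.of_forall fun ω => by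
        rw [Real.norm_of_nonneg (D.N_nonneg i t ω)]; exact D.N_le_one i t ω)
  -- The compensator is integrable as the difference of the bounded N_i and the integrable
  -- martingale.
  have hCint : ∀ t ∈ Set.Icc (0 : ℝ) τ, Integrable (C t) P := fun t ht => by
    have h1 := (hN t).sub ((hI i).integrable ⟨t, ht⟩)
    refine h1.congr (Eventually.of_forall fun ω => ?_)
    simp [hC]
  have hamem : a ∈ Set.Icc (0 : ℝ) τ := ⟨ha, hab.trans hb⟩
  have hbmem : b ∈ Set.Icc (0 : ℝ) τ := ⟨ha.trans hab, hb⟩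
  have hAhist : MeasurableSet[D.history τ ⟨a, hamem⟩] (D.z i ⁻¹' s) := by
    have hle : MeasurableSpace.comap (D.z i) inferInstance ≤ D.history τ ⟨a, hamem⟩ :=
      le_trans le_sup_left (le_iSup (fun i : Fin n => MeasurableSpace.comap (D.z i) inferInstance ⊔
        ⨆ s : Set.Icc (0 : ℝ) τ, ⨆ _ : s ≤ ⟨a, hamem⟩,
          (MeasurableSpace.comap (D.N i s) inferInstance ⊔
            MeasurableSpace.comap (D.Y i s) inferInstance)) i)
    exact hle _ ⟨s, hs, rfl⟩
  have hM : ∫ ω in D.z i ⁻¹' s, (D.N i a ω - C a ω) ∂P =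
      ∫ ω in D.z i ⁻¹' s, (D.N i b ω - C b ω) ∂P :=
    (hI i).setIntegral_eq (i := ⟨a, hamem⟩) (j := ⟨b, hbmem⟩) hab hAhist
  rw [integral_sub (hN a).integrableOn (hCint a hamem).integrableOn,
    integral_sub (hN b).integrableOn (hCint b hbmem).integrableOn] at hM
  have hCdiff : ∀ ω, C b ω - C a ω =
      ∫ u in a..b, D.Y i u ω * hazardRate lam j β γ u (D.z i ω) := fun ω => by
    have hint := (intervalIntegrable_iff_integrableOn_Ioc_of_le hτ).2
      (D.integrableOn_Y_mul_hazardRate hτ hlam hΛ j β γ i ω)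
    refine intervalIntegral.integral_interval_sub_left (hint.mono_set ?_) (hint.mono_set ?_)
    · rw [Set.uIcc_of_le hbmem.1, Set.uIcc_of_le hτ]; exact Set.Icc_subset_Icc_right hb
    · rw [Set.uIcc_of_le ha, Set.uIcc_of_le hτ]; exact Set.Icc_subset_Icc_right hamem.2
  have hkey : ∫ ω in D.z i ⁻¹' s, (C b ω - C a ω) ∂P =
      ∫ ω in D.z i ⁻¹' s, (D.N i b ω - D.N i a ω) ∂P := by
    rw [integral_sub (hN b).integrableOn (hN a).integrableOn,
      integral_sub (hCint b hbmem).integrableOn (hCint a hamem).integrableOn]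
    linarith
  simp only [D.N_sub_N_eq_indicator i hab] at hkey
  rw [integral_indicator_const _ hF, smul_eq_mul, mul_one, measureReal_def,
    Measure.restrict_apply hF] at hkey
  have hd : Integrable (fun ω => C b ω - C a ω) P := (hCint b hbmem).sub (hCint a hamem)
  rw [← ENNReal.ofReal_toReal (measure_ne_top P _), ← hkey,
    ofReal_integral_eq_lintegral_ofReal hd.integrableOn]
  · simp only [hCdiff]
  · refine Eventually.of_forall fun ω => ?_
    simp only [Pi.zero_apply, hCdiff]
    refine intervalIntegral.integral_nonneg hab fun u hu => ?_
    exact mul_nonneg (D.Y_nonneg i u ω) (mul_nonneg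
      (hazardFactor_nonneg j _ (cumHazard_nonneg hlam (ha.trans hu.1)) β γ) (hlam u))

theorem restrict_hazardMeasure_Ioc (a b : ℝ) :
    (hazardMeasure lam τ).restrict (Set.Ioc a b) =
      (hazardMeasure lam τ).restrict (Set.Ioc (max a 0) (min b τ)) := by
  rw [hazardMeasure, restrict_withDensity measurableSet_Ioc, restrict_withDensity measurableSet_Ioc,
    Measure.restrict_restrict measurableSet_Ioc, Measure.restrict_restrict measurableSet_Ioc,
    Set.Ioc_inter_Ioc, Set.Ioc_inter_Ioc]
  congr 3
  · simp
  · simp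

/-- The event that the failure of unit `i` is observed in `[0, τ]`. -/
def failureEvent (i : Fin n) (τ : ℝ) : Set Ω :=
  {ω | D.X i ω ≤ ENNReal.ofReal τ ∧ D.δ i ω = 1}

theorem measurableSet_failureEvent (i : Fin n) (τ : ℝ) : MeasurableSet (D.failureEvent i τ) :=
  (measurableSet_le (D.measurable_X i) measurable_const).inter
    ((D.measurable_δ i) (measurableSet_singleton 1))

/-- The law of the covariates and the failure time on the event that the failure is observed. -/
theorem map_restrict_failureEvent (hτ : 0 < τ) (hlam : ∀ t, 0 ≤ lam t)
    (hΛ : IntervalIntegrable lam volume 0 τ) {j : Fin m} {β : EuclideanSpace ℝ (Fin m)} {γ : ℝ}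
    (hH : D.HasHazard P τ (hazardRate lam j β γ))
    (hI : D.HasIntensity P τ (hazardRate lam j β γ)) (i : Fin n) :
    (P.restrict (D.failureEvent i τ)).map (fun ω => (D.z i ω, (D.X i ω).toReal)) =
      ((P.prod (hazardMeasure lam τ)).withDensity
        fun p => ENNReal.ofReal (D.relativeIntensity lam j β γ i p)).map
          (fun p => (D.z i p.1, p.2)) := by
  have hfin := isFiniteMeasure_hazardMeasure hτ.le hΛ
  have hmX : Measurable fun ω => (D.X i ω).toReal := (D.measurable_X i).ennreal_toReal
  have hm1 : Measurable fun ω => (D.z i ω, (D.X i ω).toReal) := (D.measurable_z i).prodMk hmX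
  have hm2 : Measurable fun p : Ω × ℝ => (D.z i p.1, p.2) :=
    ((D.measurable_z i).comp measurable_fst).prodMk measurable_snd
  have hfin1 := Measure.isFiniteMeasure_map (P.restrict (D.failureEvent i τ))
    (fun ω => (D.z i ω, (D.X i ω).toReal))
  -- Rectangles determine the two measures; for a fixed covariate set s, the time component is
  -- tested on half-open intervals.
  refine Measure.ext_prod fun {s t} hs ht => ?_
  have hA : MeasurableSet (D.z i ⁻¹' s) := D.measurable_z i hs
  have hext : (P.restrict (D.failureEvent i τ ∩ D.z i ⁻¹' s)).map (fun ω => (D.X i ω).toReal) =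
      (((P.prod (hazardMeasure lam τ)).withDensity
        fun p => ENNReal.ofReal (D.relativeIntensity lam j β γ i p)).restrict
          (Prod.fst ⁻¹' (D.z i ⁻¹' s))).map Prod.snd := by
    refine Measure.ext_of_Ioc _ _ fun {a b} hab => ?_
    rw [Measure.map_apply hmX measurableSet_Ioc, Measure.map_apply measurable_snd measurableSet_Ioc,
      Measure.restrict_apply (hmX measurableSet_Ioc),
      Measure.restrict_apply (measurable_snd measurableSet_Ioc),
      withDensity_apply _ ((measurable_snd measurableSet_Ioc).inter (measurable_fst hA)),
      Set.inter_comm (Prod.snd ⁻¹' _), ← Set.prod_eq, ← Measure.prod_restrict,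
      restrict_hazardMeasure_Ioc, lintegral_prod]
    swap
    · refine ((D.aemeasurable_relativeIntensity P hτ.le hΛ j β γ i).ennreal_ofReal).mono_measure ?_
      rw [Measure.prod_restrict]
      exact Measure.restrict_le_self
    -- Up to the null event of a failure at time 0, an observed failure in (a, b] is one in the
    -- clipped interval (max a 0, min b τ], where the martingale identity applies.
    have hae : ((fun ω => (D.X i ω).toReal) ⁻¹' Set.Ioc a b ∩
          (D.failureEvent i τ ∩ D.z i ⁻¹' s) : Set Ω) =ᵐ[P]
        ({ω | ENNReal.ofReal (max a 0) < D.X i ω ∧ D.X i ω ≤ ENNReal.ofReal (min b τ) ∧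
          D.δ i ω = 1} ∩ D.z i ⁻¹' s : Set Ω) := by
      filter_upwards [D.ae_N_zero_eq_zero hτ hH i] with ω hω
      refine propext ?_
      change (a < (D.X i ω).toReal ∧ (D.X i ω).toReal ≤ b) ∧
        (D.X i ω ≤ ENNReal.ofReal τ ∧ D.δ i ω = 1) ∧ D.z i ω ∈ s ↔
        (ENNReal.ofReal (max a 0) < D.X i ω ∧ D.X i ω ≤ ENNReal.ofReal (min b τ) ∧
          D.δ i ω = 1) ∧ D.z i ω ∈ s
      by_cases hX : D.X i ω = ∞
      · simp [hX]
      obtain ⟨x, hx0, hx⟩ : ∃ x : ℝ, 0 ≤ x ∧ D.X i ω = ENNReal.ofReal x :=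
        ⟨(D.X i ω).toReal, ENNReal.toReal_nonneg, (ENNReal.ofReal_toReal hX).symm⟩
      by_cases hδ : D.δ i ω = 1
      swap
      · simp [hδ]
      have hxpos : 0 < x := by
        rcases hx0.eq_or_lt with h0 | h0
        · exfalso
          have : D.N i 0 ω = 1 := Set.indicator_of_mem
            (s := {ω | D.X i ω ≤ ENNReal.ofReal 0 ∧ D.δ i ω = 1}) ⟨by rw [hx, ← h0], hδ⟩ _
          rw [hω] at this
          exact zero_ne_one this
        · exact h0
      rw [hx, ENNReal.toReal_ofReal hx0, ENNReal.ofReal_lt_ofReal_iff hxpos,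
        ENNReal.ofReal_le_ofReal_iff hτ.le, max_lt_iff]
      by_cases hb : 0 ≤ min b τ
      · rw [ENNReal.ofReal_le_ofReal_iff hb, le_min_iff]
        tauto
      -- As τ > 0, a negative min b τ means b < 0; then neither event can occur at a positive time
      -- x.
      · have hb' : b < 0 := by
          by_contra hc
          exact hb (le_min (not_lt.1 hc) hτ.le)
        rw [ENNReal.ofReal_of_nonpos (not_le.1 hb).le]
        have h1 : ¬ x ≤ b := not_le.2 (hb'.trans hxpos)
        have h2 : ¬ ENNReal.ofReal x ≤ 0 := by simpa using hxpos
        tauto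
    rw [measure_congr hae]
    rcases le_total (max a 0) (min b τ) with hle | hle
    · rw [D.measure_failure_eq_lintegral hτ.le hlam hΛ hI i hs (le_max_right _ _) hle
        (min_le_right _ _)]
      refine lintegral_congr fun ω => ?_
      rw [D.lintegral_relativeIntensity hτ.le hlam hΛ j β γ i (le_max_right _ _) hle
        (min_le_right _ _)]
    · rw [Set.Ioc_eq_empty (not_lt.2 hle)]
      simp only [Measure.restrict_empty, lintegral_zero_measure, lintegral_const, zero_mul]
      convert measure_empty (μ := P)
      ext ω
      simp only [Set.mem_inter_iff, Set.mem_empty_iff_false, iff_false]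
      rintro ⟨⟨h1, h2, -⟩, -⟩
      exact absurd (h1.trans_le h2) (not_lt.2 (ENNReal.ofReal_le_ofReal hle))
  have h1 := DFunLike.congr_fun hext t
  rw [Measure.map_apply hmX ht, Measure.map_apply measurable_snd ht,
    Measure.restrict_apply (hmX ht), Measure.restrict_apply (measurable_snd ht)] at h1
  rw [Measure.map_apply hm1 (hs.prod ht), Measure.map_apply hm2 (hs.prod ht),
    Measure.restrict_apply (hm1 (hs.prod ht))]
  convert h1 using 2
  · ext ω
    simp only [Set.mem_inter_iff, Set.mem_preimage, Set.mem_prod]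
    tauto
  · ext p
    simp only [Set.mem_inter_iff, Set.mem_preimage, Set.mem_prod]
    tauto

end SurvivalSample

/-! ### Fluctuations of sums of independent bounded variables -/

section Independence

variable {Ω : Type*} [MeasurableSpace Ω] {P : Measure Ω} [IsProbabilityMeasure P]

/-- The variance of the sum is at most the number of terms times c², and the L¹ norm is at most the
L² norm. -/
theorem lintegral_abs_sum_sub_integral_le {ι : Type*} [Fintype ι] {ξ : ι → Ω → ℝ} {c : ℝ}
    (hc : 0 ≤ c) (hind : iIndepFun ξ P) (hm : ∀ k, Measurable (ξ k))
    (hb : ∀ k, ∀ᵐ ω ∂P, |ξ k ω| ≤ c) (T : Finset ι) :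
    ∫⁻ ω, ENNReal.ofReal |∑ k ∈ T, (ξ k ω - ∫ ω', ξ k ω' ∂P)| ∂P ≤
      ENNReal.ofReal (√(Fintype.card ι) * c) := by
  have hL : ∀ k, MemLp (ξ k) 2 P := fun k =>
    MemLp.of_bound (hm k).aestronglyMeasurable c (by simpa only [Real.norm_eq_abs] using hb k)
  have hi : ∀ k, Integrable (ξ k) P := fun k => (hL k).integrable one_le_two
  set Z : Ω → ℝ := fun ω => ∑ k ∈ T, (ξ k ω - ∫ ω', ξ k ω' ∂P) with hZ
  have hZL : MemLp Z 2 P := memLp_finsetSum T fun k _ => (hL k).sub (memLp_const _)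
  have hsum : MemLp (∑ k ∈ T, ξ k) 2 P := memLp_finsetSum' T fun k _ => hL k
  have hvar : ∫ ω, Z ω ^ 2 ∂P ≤ Fintype.card ι * c ^ 2 := by
    have h1 : ∫ ω, Z ω ^ 2 ∂P = variance (∑ k ∈ T, ξ k) P := by
      rw [variance_eq_integral hsum.aestronglyMeasurable.aemeasurable]
      refine integral_congr_ae (Eventually.of_forall fun ω => ?_)
      simp only [Finset.sum_apply, hZ]
      rw [integral_finsetSum _ fun k _ => hi k, Finset.sum_sub_distrib]
    rw [h1, IndepFun.variance_sum (fun k _ => hL k)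
      (fun k _ l _ hkl => hind.indepFun hkl)]
    calc ∑ k ∈ T, variance (ξ k) P ≤ ∑ k ∈ T, c ^ 2 := by
          refine Finset.sum_le_sum fun k _ => ?_
          have := variance_le_sq_of_bounded (μ := P) (a := -c) (b := c) (X := ξ k)
            ((hb k).mono fun ω h => abs_le.1 h) (hm k).aemeasurable
          calc _ ≤ _ := this
            _ = c ^ 2 := by ring
      _ ≤ Fintype.card ι * c ^ 2 := by
          rw [Finset.sum_const, nsmul_eq_mul]
          exact mul_le_mul_of_nonneg_right (by exact_mod_cast Finset.card_le_univ T) (sq_nonneg c)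
  have habs : MemLp (fun ω => |Z ω|) 2 P := hZL.abs
  have h2 : (∫ ω, |Z ω| ∂P) ^ 2 ≤ ∫ ω, Z ω ^ 2 ∂P := by
    have h3 := variance_eq_sub habs
    have h4 := variance_nonneg (fun ω => |Z ω|) P
    simp only [Pi.pow_apply, sq_abs] at h3
    linarith
  rw [← ofReal_integral_eq_lintegral_ofReal (habs.integrable one_le_two)
    (Eventually.of_forall fun ω => abs_nonneg _)]
  refine ENNReal.ofReal_le_ofReal (abs_le_of_sq_le_sq' ?_ (by positivity)).2
  rw [mul_pow, Real.sq_sqrt (Nat.cast_nonneg _)]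
  exact h2.trans hvar

/-- By independence the joint law is a product; Tonelli freezes A and bounds the inner integral over
B. -/
theorem lintegral_mul_le_of_indepFun {α β : Type*} [MeasurableSpace α] [MeasurableSpace β]
    {A : Ω → α} {B : Ω → β} (hA : Measurable A) (hB : Measurable B) (hAB : IndepFun A B P)
    {H : α → ℝ≥0∞} (hH : Measurable H) {F : α → β → ℝ≥0∞} (hF : Measurable (Function.uncurry F))
    {c : ℝ≥0∞} (hc : ∀ a, ∫⁻ ω, F a (B ω) ∂P ≤ c) :
    ∫⁻ ω, H (A ω) * F (A ω) (B ω) ∂P ≤ c * ∫⁻ ω, H (A ω) ∂P := by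
  have hg : Measurable fun p : α × β => H p.1 * F p.1 p.2 := (hH.comp measurable_fst).mul hF
  have h1 : ∫⁻ ω, H (A ω) * F (A ω) (B ω) ∂P =
      ∫⁻ p, H p.1 * F p.1 p.2 ∂(P.map fun ω => (A ω, B ω)) :=
    (lintegral_map hg (hA.prodMk hB)).symm
  rw [h1, (indepFun_iff_map_prod_eq_prod_map_map hA.aemeasurable hB.aemeasurable).1 hAB,
    lintegral_prod _ hg.aemeasurable, lintegral_map hg.lintegral_prod_right' hA,
    ← lintegral_const_mul _ (show Measurable fun ω => H (A ω) from hH.comp hA)]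
  refine lintegral_mono fun ω => ?_
  have hFa : Measurable (F (A ω)) := hF.comp measurable_prodMk_left
  simp only
  rw [lintegral_const_mul _ hFa, mul_comm, lintegral_map hFa hB]
  exact mul_le_mul_left (hc _) _

/-- Given one observation, a centered sum over the other independent observations is of order the
square root of their number. -/
theorem lintegral_mul_abs_sum_erase_le {ι : Type*} [Fintype ι] [DecidableEq ι] {O : Type*}
    [MeasurableSpace O] {obs : ι → Ω → O} (hobs : ∀ k, Measurable (obs k))
    (hind : iIndepFun obs P) (i : ι) {H : O → ℝ≥0∞} (hH : Measurable H) {x : O → ℝ}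
    (hx : Measurable x) {g : O → ℝ → ℝ} (hg : Measurable (Function.uncurry g)) {c : ℝ} (hc : 0 ≤ c)
    (hb : ∀ k u, ∀ᵐ ω ∂P, |g (obs k ω) u| ≤ c) :
    ∫⁻ ω, H (obs i ω) * ENNReal.ofReal |∑ k ∈ Finset.univ.erase i,
        (g (obs k ω) (x (obs i ω)) - ∫ ω', g (obs k ω') (x (obs i ω)) ∂P)| ∂P ≤
      ENNReal.ofReal (√(Fintype.card ι) * c) * ∫⁻ ω, H (obs i ω) ∂P := by
  have hdisj : Disjoint ({i} : Finset ι) (Finset.univ.erase i) := by simp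
  have hi : i ∈ ({i} : Finset ι) := Finset.mem_singleton_self i
  -- Only i ∈ S and the disjointness of S and T are used below: they split the observations into two
  -- independent blocks.
  generalize ({i} : Finset ι) = S at hi hdisj
  generalize Finset.univ.erase i = T at hdisj ⊢
  have hmean : ∀ k, Measurable fun u => ∫ ω', g (obs k ω') u ∂P := fun k =>
    StronglyMeasurable.measurable (StronglyMeasurable.integral_prod_left'
      (f := fun p : Ω × ℝ => g (obs k p.1) p.2)
      (hg.comp (((hobs k).comp measurable_fst).prodMk measurable_snd)).stronglyMeasurable)
  let F : (S → O) → (T → O) → ℝ≥0∞ := fun a b =>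
    ENNReal.ofReal |∑ k, (g (b k) (x (a ⟨i, hi⟩)) - ∫ ω', g (obs k ω') (x (a ⟨i, hi⟩)) ∂P)|
  have hFm : Measurable (Function.uncurry F) := by
    have h1 : Measurable fun p : (S → O) × (T → O) =>
        x (p.1 ⟨i, hi⟩) := hx.comp ((measurable_pi_apply (⟨i, hi⟩ : S)).comp measurable_fst)
    have h2 : Measurable fun p : (S → O) × (T → O) =>
        ∑ k, (g (p.2 k) (x (p.1 ⟨i, hi⟩)) - ∫ ω', g (obs k ω') (x (p.1 ⟨i, hi⟩)) ∂P) :=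
      Finset.measurable_sum _ fun k _ => Measurable.sub
        (hg.comp (((measurable_pi_apply k).comp measurable_snd).prodMk h1)) ((hmean k).comp h1)
    exact h2.abs.ennreal_ofReal
  have hbound : ∀ a, ∫⁻ ω, F a (fun k => obs k ω) ∂P ≤ ENNReal.ofReal (√(Fintype.card ι) * c) :=
    fun a => by
      have h2 := lintegral_abs_sum_sub_integral_le (P := P)
        (ξ := fun k ω => g (obs k ω) (x (a ⟨i, hi⟩))) hc
        (hind.comp (fun _ o => g o (x (a ⟨i, hi⟩))) fun _ => hg.comp measurable_prodMk_right)
        (fun k => (hg.comp measurable_prodMk_right).comp (hobs k)) (fun k => hb k _)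
        T
      refine le_trans (le_of_eq (lintegral_congr fun ω => ?_)) h2
      rw [← Finset.sum_coe_sort]
  have key := lintegral_mul_le_of_indepFun (P := P)
    (measurable_pi_lambda _ fun k : S => hobs k)
    (measurable_pi_lambda _ fun k : T => hobs k)
    (hind.indepFun_finset S T hdisj hobs)
    (H := fun a => H (a ⟨i, hi⟩)) (hH.comp (measurable_pi_apply _)) hFm hbound
  refine le_trans (le_of_eq (lintegral_congr fun ω => ?_)) key
  rw [← Finset.sum_coe_sort]

end Independence

/-! ### Empirical and population risk sums and their ratios -/

namespace SurvivalSample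

variable {m n : ℕ} {Ω : Type*} [mΩ : MeasurableSpace Ω] (D : SurvivalSample m n Ω)

/-- The contribution of unit `k` to the `φ`-weighted risk sum. -/
noncomputable def riskTerm (φ : EuclideanSpace ℝ (Fin m) → ℝ) (β : EuclideanSpace ℝ (Fin m))
    (k : Fin n) (u : ℝ) (ω : Ω) : ℝ :=
  D.Y k u ω * Real.exp (inner ℝ β (D.z k ω)) * φ (D.z k ω)

/-- The risk sum weighted by a function `φ` of the covariates. -/
noncomputable def riskSum (φ : EuclideanSpace ℝ (Fin m) → ℝ) (β : EuclideanSpace ℝ (Fin m))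
    (u : ℝ) (ω : Ω) : ℝ :=
  ∑ k, D.riskTerm φ β k u ω

/-- The normalized expectation of the risk sum. -/
noncomputable def meanRiskSum (P : Measure Ω) (φ : EuclideanSpace ℝ (Fin m) → ℝ)
    (β : EuclideanSpace ℝ (Fin m)) (u : ℝ) : ℝ :=
  (∫ ω, D.riskSum φ β u ω ∂P) / n

/-- The average of `φ` over the risk set. -/
noncomputable def riskRatio (φ : EuclideanSpace ℝ (Fin m) → ℝ) (β : EuclideanSpace ℝ (Fin m))
    (u : ℝ) (ω : Ω) : ℝ :=
  D.riskSum φ β u ω / D.riskSum 1 β u ω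

/-- The population average of `φ` over the risk set. -/
noncomputable def meanRiskRatio (P : Measure Ω) (φ : EuclideanSpace ℝ (Fin m) → ℝ)
    (β : EuclideanSpace ℝ (Fin m)) (u : ℝ) : ℝ :=
  D.meanRiskSum P φ β u / D.meanRiskSum P 1 β u

variable {P : Measure Ω} [IsProbabilityMeasure P] {K M : ℝ}
  {φ : EuclideanSpace ℝ (Fin m) → ℝ} {β : EuclideanSpace ℝ (Fin m)}

theorem measurable_riskTerm (hφ : Measurable φ) (k : Fin n) :
    Measurable fun p : Ω × ℝ => D.riskTerm φ β k p.2 p.1 := by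
  have hz : Measurable fun p : Ω × ℝ => D.z k p.1 := (D.measurable_z k).comp measurable_fst
  exact ((D.measurable_Y_prod k).mul (by fun_prop)).mul (hφ.comp hz)

theorem measurable_riskTerm_apply (hφ : Measurable φ) (k : Fin n) (u : ℝ) :
    Measurable (D.riskTerm φ β k u) :=
  (D.measurable_riskTerm hφ k).comp measurable_prodMk_right

theorem measurable_riskSum (hφ : Measurable φ) :
    Measurable fun p : Ω × ℝ => D.riskSum φ β p.2 p.1 :=
  Finset.measurable_sum _ fun k _ => D.measurable_riskTerm hφ k

theorem measurable_integral_riskTerm (hφ : Measurable φ) (k : Fin n) :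
    Measurable fun u => ∫ ω, D.riskTerm φ β k u ω ∂P :=
  (D.measurable_riskTerm hφ k).stronglyMeasurable.integral_prod_left'.measurable

theorem measurable_meanRiskSum (hφ : Measurable φ) : Measurable (D.meanRiskSum P φ β) :=
  (D.measurable_riskSum hφ).stronglyMeasurable.integral_prod_left'.measurable.div_const _

theorem measurable_riskRatio (hφ : Measurable φ) :
    Measurable fun p : Ω × ℝ => D.riskRatio φ β p.2 p.1 :=
  (D.measurable_riskSum hφ).div (D.measurable_riskSum measurable_one)

theorem measurable_riskRatio_comp (hφ : Measurable φ) {x : Ω → ℝ} (hx : Measurable x) :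
    Measurable fun ω => D.riskRatio φ β (x ω) ω := by
  have h := (D.measurable_riskRatio (β := β) hφ).comp (measurable_id.prodMk hx)
  simp only [Function.comp_def, id] at h
  exact h

theorem measurable_meanRiskRatio (hφ : Measurable φ) : Measurable (D.meanRiskRatio P φ β) :=
  (D.measurable_meanRiskSum hφ).div (D.measurable_meanRiskSum measurable_one)

theorem riskTerm_one_nonneg (k : Fin n) (u : ℝ) (ω : Ω) : 0 ≤ D.riskTerm 1 β k u ω := by
  simpa [riskTerm] using mul_nonneg (D.Y_nonneg k u ω) (Real.exp_pos _).le

theorem riskTerm_eq_mul (k : Fin n) (u : ℝ) (ω : Ω) :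
    D.riskTerm φ β k u ω = D.riskTerm 1 β k u ω * φ (D.z k ω) := by
  simp [riskTerm]

theorem riskTerm_one_le {ω : Ω} (hz : ∀ k, ‖D.z k ω‖ ≤ K) (k : Fin n) (u : ℝ) :
    D.riskTerm 1 β k u ω ≤ Real.exp (‖β‖ * K) := by
  have h1 : Real.exp (inner ℝ β (D.z k ω)) ≤ Real.exp (‖β‖ * K) :=
    Real.exp_le_exp.2 ((real_inner_le_norm _ _).trans
      (mul_le_mul_of_nonneg_left (hz k) (norm_nonneg _)))
  calc D.riskTerm 1 β k u ω = D.Y k u ω * Real.exp (inner ℝ β (D.z k ω)) := by simp [riskTerm]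
    _ ≤ 1 * Real.exp (‖β‖ * K) :=
      mul_le_mul (D.Y_le_one k u ω) h1 (Real.exp_pos _).le zero_le_one
    _ = _ := one_mul _

theorem abs_riskTerm_le_mul (hφK : ∀ z, ‖z‖ ≤ K → |φ z| ≤ M) {ω : Ω} (hz : ∀ k, ‖D.z k ω‖ ≤ K)
    (k : Fin n) (u : ℝ) : |D.riskTerm φ β k u ω| ≤ M * D.riskTerm 1 β k u ω := by
  rw [riskTerm_eq_mul, abs_mul, abs_of_nonneg (D.riskTerm_one_nonneg k u ω), mul_comm]
  exact mul_le_mul_of_nonneg_right (hφK _ (hz k)) (D.riskTerm_one_nonneg k u ω)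

theorem abs_riskTerm_le (hM : 0 ≤ M) (hφK : ∀ z, ‖z‖ ≤ K → |φ z| ≤ M) {ω : Ω}
    (hz : ∀ k, ‖D.z k ω‖ ≤ K) (k : Fin n) (u : ℝ) :
    |D.riskTerm φ β k u ω| ≤ Real.exp (‖β‖ * K) * M := by
  refine (D.abs_riskTerm_le_mul hφK hz k u).trans ?_
  rw [mul_comm]
  exact mul_le_mul_of_nonneg_right (D.riskTerm_one_le hz k u) hM

theorem riskSum_one_nonneg (u : ℝ) (ω : Ω) : 0 ≤ D.riskSum 1 β u ω :=
  Finset.sum_nonneg fun k _ => D.riskTerm_one_nonneg k u ω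

theorem abs_riskSum_le (hφK : ∀ z, ‖z‖ ≤ K → |φ z| ≤ M) {ω : Ω} (hz : ∀ k, ‖D.z k ω‖ ≤ K)
    (u : ℝ) : |D.riskSum φ β u ω| ≤ M * D.riskSum 1 β u ω := by
  rw [riskSum, riskSum, Finset.mul_sum]
  exact (Finset.abs_sum_le_sum_abs _ _).trans
    (Finset.sum_le_sum fun k _ => D.abs_riskTerm_le_mul hφK hz k u)

theorem integrable_riskTerm (hφ : Measurable φ) (hφK : ∀ z, ‖z‖ ≤ K → |φ z| ≤ M) (hM : 0 ≤ M)
    (hz : ∀ᵐ ω ∂P, ∀ k, ‖D.z k ω‖ ≤ K) (k : Fin n) (u : ℝ) :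
    Integrable (D.riskTerm φ β k u) P :=
  Integrable.of_bound
    ((D.measurable_riskTerm hφ k).comp measurable_prodMk_right).aestronglyMeasurable _
    (hz.mono fun _ h => D.abs_riskTerm_le hM hφK h k u)

theorem integrable_riskSum (hφ : Measurable φ) (hφK : ∀ z, ‖z‖ ≤ K → |φ z| ≤ M) (hM : 0 ≤ M)
    (hz : ∀ᵐ ω ∂P, ∀ k, ‖D.z k ω‖ ≤ K) (u : ℝ) : Integrable (D.riskSum φ β u) P :=
  integrable_finsetSum _ fun k _ => D.integrable_riskTerm hφ hφK hM hz k u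

theorem integrable_riskSum_one (hz : ∀ᵐ ω ∂P, ∀ k, ‖D.z k ω‖ ≤ K) (u : ℝ) :
    Integrable (D.riskSum 1 β u) P :=
  D.integrable_riskSum measurable_one (fun _ _ => (abs_one (α := ℝ)).le) zero_le_one hz u

theorem meanRiskSum_one_nonneg (Q : Measure Ω) (β : EuclideanSpace ℝ (Fin m)) (u : ℝ) : 0 ≤ D.meanRiskSum Q 1 β u :=
  div_nonneg (integral_nonneg fun ω => D.riskSum_one_nonneg u ω) (Nat.cast_nonneg _)

theorem abs_meanRiskSum_le (hφK : ∀ z, ‖z‖ ≤ K → |φ z| ≤ M)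
    (hz : ∀ᵐ ω ∂P, ∀ k, ‖D.z k ω‖ ≤ K) (u : ℝ) :
    |D.meanRiskSum P φ β u| ≤ M * D.meanRiskSum P 1 β u := by
  rw [meanRiskSum, meanRiskSum, abs_div, Nat.abs_cast, ← mul_div_assoc]
  refine div_le_div_of_nonneg_right ?_ (Nat.cast_nonneg _)
  rw [← integral_const_mul]
  refine abs_integral_le_integral_abs.trans (integral_mono_of_nonneg
    (Eventually.of_forall fun _ => abs_nonneg _) ((D.integrable_riskSum_one hz u).const_mul M) ?_)
  filter_upwards [hz] with ω hω using D.abs_riskSum_le hφK hω u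

theorem abs_div_le_of_abs_le_mul {x y M : ℝ} (hM : 0 ≤ M) (hy : 0 ≤ y) (h : |x| ≤ M * y) :
    |x / y| ≤ M := by
  rw [abs_div, abs_of_nonneg hy]
  exact div_le_of_le_mul₀ hy hM h

theorem abs_riskRatio_le (hM : 0 ≤ M) (hφK : ∀ z, ‖z‖ ≤ K → |φ z| ≤ M) {ω : Ω}
    (hz : ∀ k, ‖D.z k ω‖ ≤ K) (u : ℝ) : |D.riskRatio φ β u ω| ≤ M :=
  abs_div_le_of_abs_le_mul hM (D.riskSum_one_nonneg u ω) (D.abs_riskSum_le hφK hz u)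

theorem abs_meanRiskRatio_le (hM : 0 ≤ M) (hφK : ∀ z, ‖z‖ ≤ K → |φ z| ≤ M)
    (hz : ∀ᵐ ω ∂P, ∀ k, ‖D.z k ω‖ ≤ K) (u : ℝ) : |D.meanRiskRatio P φ β u| ≤ M :=
  abs_div_le_of_abs_le_mul hM (D.meanRiskSum_one_nonneg P β u) (D.abs_meanRiskSum_le hφK hz u)

/-- Holds at a zero denominator too: |S_φ| ≤ M S_1 makes the numerator vanish with it, in agreement
with x / 0 = 0. -/
theorem riskRatio_mul (hφK : ∀ z, ‖z‖ ≤ K → |φ z| ≤ M) {ω : Ω}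
    (hz : ∀ k, ‖D.z k ω‖ ≤ K) (u : ℝ) :
    D.riskRatio φ β u ω * D.riskSum 1 β u ω = D.riskSum φ β u ω := by
  refine div_mul_cancel_of_imp fun h => ?_
  have := D.abs_riskSum_le (β := β) hφK hz u
  rw [h, mul_zero] at this
  exact abs_nonpos_iff.1 this

theorem meanRiskRatio_mul (hφK : ∀ z, ‖z‖ ≤ K → |φ z| ≤ M)
    (hz : ∀ᵐ ω ∂P, ∀ k, ‖D.z k ω‖ ≤ K) (u : ℝ) :
    D.meanRiskRatio P φ β u * D.meanRiskSum P 1 β u = D.meanRiskSum P φ β u := by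
  refine div_mul_cancel_of_imp fun h => ?_
  have := D.abs_meanRiskSum_le (β := β) hφK hz u
  rw [h, mul_zero] at this
  exact abs_nonpos_iff.1 this

/-- The deviation of the empirical from the population average over the risk set is controlled by
the deviations of the risk sums. -/
theorem meanRiskSum_mul_abs_riskRatio_sub_le (hM : 0 ≤ M) (hφK : ∀ z, ‖z‖ ≤ K → |φ z| ≤ M)
    (hzP : ∀ᵐ ω ∂P, ∀ k, ‖D.z k ω‖ ≤ K) {ω : Ω} (hz : ∀ k, ‖D.z k ω‖ ≤ K) (u : ℝ) :
    D.meanRiskSum P 1 β u * |D.riskRatio φ β u ω - D.meanRiskRatio P φ β u| ≤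
      |D.riskSum φ β u ω / n - D.meanRiskSum P φ β u| +
        M * |D.riskSum 1 β u ω / n - D.meanRiskSum P 1 β u| := by
  have h1 := D.riskRatio_mul (β := β) hφK hz u
  have h2 := D.meanRiskRatio_mul (β := β) hφK hzP u
  have h3 := D.abs_riskRatio_le (β := β) hM hφK hz u
  rw [← abs_of_nonneg (D.meanRiskSum_one_nonneg P β u), ← abs_mul]
  -- With R = S_φ/S_1 and population value ρ = s_φ/s_1, the identity s_1(R - ρ) = (S_φ/n - s_φ) -
  -- R(S_1/n - s_1) avoids dividing by s_1, and |R| ≤ M.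
  have h4 : D.meanRiskSum P 1 β u * (D.riskRatio φ β u ω - D.meanRiskRatio P φ β u) =
      (D.riskSum φ β u ω / n - D.meanRiskSum P φ β u) -
        D.riskRatio φ β u ω * (D.riskSum 1 β u ω / n - D.meanRiskSum P 1 β u) := by
    rw [← h1, ← h2]; ring
  rw [h4, abs_of_nonneg (D.meanRiskSum_one_nonneg P β u)]
  refine (abs_sub _ _).trans ?_
  rw [abs_mul]
  gcongr

/-- The centered risk sum over all units but `i`. -/
noncomputable def centeredRiskSum (P : Measure Ω) (φ : EuclideanSpace ℝ (Fin m) → ℝ)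
    (β : EuclideanSpace ℝ (Fin m)) (i : Fin n) (u : ℝ) (ω : Ω) : ℝ :=
  ∑ k ∈ Finset.univ.erase i, (D.riskTerm φ β k u ω - ∫ ω', D.riskTerm φ β k u ω' ∂P)

theorem measurable_centeredRiskSum (hφ : Measurable φ) (i : Fin n) :
    Measurable fun p : Ω × ℝ => D.centeredRiskSum P φ β i p.2 p.1 :=
  Finset.measurable_sum _ fun k _ => (D.measurable_riskTerm hφ k).sub
    ((D.measurable_integral_riskTerm hφ k).comp measurable_snd)

theorem measurable_centeredRiskSum_comp (hφ : Measurable φ) (i : Fin n) {x : Ω → ℝ}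
    (hx : Measurable x) : Measurable fun ω => D.centeredRiskSum P φ β i (x ω) ω := by
  have h := (D.measurable_centeredRiskSum (P := P) (β := β) hφ i).comp (measurable_id.prodMk hx)
  simp only [Function.comp_def, id] at h
  exact h

/-- Setting aside the term of unit i costs a bounded amount; for independent observations the
remaining sum, at a fixed time, is independent of unit i. -/
theorem abs_riskSum_div_sub_meanRiskSum_le (hM : 0 ≤ M) (hφ : Measurable φ)
    (hφK : ∀ z, ‖z‖ ≤ K → |φ z| ≤ M)
    (hzP : ∀ᵐ ω ∂P, ∀ k, ‖D.z k ω‖ ≤ K) {ω : Ω} (hz : ∀ k, ‖D.z k ω‖ ≤ K) (i : Fin n) (u : ℝ) :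
    |D.riskSum φ β u ω / n - D.meanRiskSum P φ β u| ≤
      (2 * (Real.exp (‖β‖ * K) * M) + |D.centeredRiskSum P φ β i u ω|) / n := by
  rw [meanRiskSum, ← sub_div, abs_div, Nat.abs_cast]
  refine div_le_div_of_nonneg_right ?_ (Nat.cast_nonneg _)
  have h1 : D.riskSum φ β u ω - ∫ ω, D.riskSum φ β u ω ∂P =
      (D.riskTerm φ β i u ω - ∫ ω', D.riskTerm φ β i u ω' ∂P) + D.centeredRiskSum P φ β i u ω := by
    simp only [riskSum, centeredRiskSum]
    rw [integral_finsetSum _ fun k _ => D.integrable_riskTerm hφ hφK hM hzP k u,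
      ← Finset.sum_sub_distrib]
    exact (Finset.add_sum_erase Finset.univ
      (fun k => D.riskTerm φ β k u ω - ∫ ω', D.riskTerm φ β k u ω' ∂P) (Finset.mem_univ i)).symm
  rw [h1]
  refine (abs_add_le _ _).trans ?_
  gcongr
  refine (abs_sub _ _).trans ?_
  have h2 := D.abs_riskTerm_le (β := β) hM hφK hz i u
  have h3 : |∫ ω', D.riskTerm φ β i u ω' ∂P| ≤ Real.exp (‖β‖ * K) * M := by
    have := norm_integral_le_of_norm_le_const (μ := P) (f := D.riskTerm φ β i u)
      (hzP.mono fun ω' h => D.abs_riskTerm_le (β := β) hM hφK h i u)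
    simpa using this
  linarith

/-- Given the observation of unit `i`, the centered risk sum over the other units is of order
`√n`. -/
theorem lintegral_centeredRiskSum_le (hM : 0 ≤ M) (hφ : Measurable φ)
    (hφK : ∀ z, ‖z‖ ≤ K → |φ z| ≤ M) (hzP : ∀ᵐ ω ∂P, ∀ k, ‖D.z k ω‖ ≤ K)
    (hind : iIndepFun D.obs P) (i : Fin n) (τ : ℝ) {ψ : ℝ → ℝ≥0∞} (hψ : Measurable ψ) :
    ∫⁻ ω in D.failureEvent i τ, ψ (D.X i ω).toReal *
        ENNReal.ofReal |D.centeredRiskSum P φ β i (D.X i ω).toReal ω| ∂P ≤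
      ENNReal.ofReal (√n * (Real.exp (‖β‖ * K) * M)) *
        ∫⁻ ω in D.failureEvent i τ, ψ (D.X i ω).toReal ∂P := by
  have hobs : ∀ k, Measurable (D.obs k) := fun k =>
    (D.measurable_X k).prodMk ((D.measurable_δ k).prodMk (D.measurable_z k))
  have hg : Measurable (Function.uncurry fun (o : ℝ≥0∞ × ℝ × EuclideanSpace ℝ (Fin m)) (u : ℝ) =>
      Set.indicator {p : ℝ≥0∞ × ℝ | ENNReal.ofReal p.2 ≤ p.1} 1 (o.1, u) *
        Real.exp (inner ℝ β o.2.2) * φ o.2.2) := by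
    have h1 : MeasurableSet {p : ℝ≥0∞ × ℝ | ENNReal.ofReal p.2 ≤ p.1} :=
      measurableSet_le (ENNReal.measurable_ofReal.comp measurable_snd) measurable_fst
    have h2 : Measurable fun p : (ℝ≥0∞ × ℝ × EuclideanSpace ℝ (Fin m)) × ℝ => p.1.2.2 := by fun_prop
    have h3 : Measurable fun p : (ℝ≥0∞ × ℝ × EuclideanSpace ℝ (Fin m)) × ℝ => (p.1.1, p.2) := by
      fun_prop
    have h4 : Measurable (Set.indicator {p : ℝ≥0∞ × ℝ | ENNReal.ofReal p.2 ≤ p.1} (1 : ℝ≥0∞ × ℝ → ℝ)) :=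
      measurable_one.indicator h1
    exact ((h4.comp h3).mul (by fun_prop)).mul (hφ.comp h2)
  have hH : Measurable (Set.indicator
      {x : ℝ≥0∞ × ℝ × EuclideanSpace ℝ (Fin m) | x.1 ≤ ENNReal.ofReal τ ∧ x.2.1 = 1}
        (fun x => ψ x.1.toReal)) := by
    refine (hψ.comp (by fun_prop)).indicator ?_
    exact (measurableSet_le measurable_fst measurable_const).inter
      ((measurable_fst.comp measurable_snd) (measurableSet_singleton (1 : ℝ)))
  have hx : Measurable fun o : ℝ≥0∞ × ℝ × EuclideanSpace ℝ (Fin m) => o.1.toReal := by fun_prop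
  have key := lintegral_mul_abs_sum_erase_le hobs hind i hH hx hg
    (mul_nonneg (Real.exp_pos (‖β‖ * K)).le hM)
    (fun k u => hzP.mono fun ω h => D.abs_riskTerm_le hM hφK h k u)
  rw [Fintype.card_fin] at key
  rw [← lintegral_indicator (D.measurableSet_failureEvent i τ),
    ← lintegral_indicator (D.measurableSet_failureEvent i τ)]
  refine le_trans (le_of_eq (lintegral_congr fun ω => ?_)) key
  rw [Set.indicator_mul_left]
  rfl

end SurvivalSample

/-! ### Laws of large numbers over the observed failures -/

namespace SurvivalSample

variable {m n : ℕ} {Ω : Type*} [mΩ : MeasurableSpace Ω] (D : SurvivalSample m n Ω)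

/-- The failures in `[0, τ]` have an intensity with respect to `μ` which differs from that of the
proportional hazards model with parameter `β` by a relative error of at most `r`. -/
def HasFailureLaw (P : Measure Ω) (τ : ℝ) (μ : Measure ℝ) (β : EuclideanSpace ℝ (Fin m))
    (r : ℝ) : Prop :=
  ∀ i, ∃ R : Ω × ℝ → ℝ, AEMeasurable R (P.prod μ) ∧
    (∀ᵐ p ∂P.prod μ, 0 ≤ R p ∧
      |R p - D.riskTerm 1 β i p.2 p.1| ≤ r * D.riskTerm 1 β i p.2 p.1) ∧
    (P.restrict (D.failureEvent i τ)).map (fun ω => (D.z i ω, (D.X i ω).toReal)) =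
      ((P.prod μ).withDensity fun p => ENNReal.ofReal (R p)).map fun p => (D.z i p.1, p.2)

variable {P : Measure Ω} [IsProbabilityMeasure P] {K M r τ : ℝ} {μ : Measure ℝ} [IsFiniteMeasure μ]
  {φ : EuclideanSpace ℝ (Fin m) → ℝ} {β : EuclideanSpace ℝ (Fin m)}

theorem hasFailureLaw_of_hasIntensity {lam : ℝ → ℝ} (hτ : 0 < τ) (hlam : ∀ t, 0 ≤ lam t)
    (hΛ : IntervalIntegrable lam volume 0 τ) {j : Fin m} {γ : ℝ}
    (hH : D.HasHazard P τ (hazardRate lam j β γ))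
    (hI : D.HasIntensity P τ (hazardRate lam j β γ)) (hz : ∀ᵐ ω ∂P, ∀ k, ‖D.z k ω‖ ≤ K) :
    D.HasFailureLaw P τ (hazardMeasure lam τ) β (Real.exp (|γ| * K) - 1) := fun i => by
  have := isFiniteMeasure_hazardMeasure hτ.le hΛ
  refine ⟨D.relativeIntensity lam j β γ i, D.aemeasurable_relativeIntensity P hτ.le hΛ j β γ i, ?_,
    D.map_restrict_failureEvent hτ hlam hΛ hH hI i⟩
  filter_upwards [Measure.quasiMeasurePreserving_fst.ae hz,
    Measure.quasiMeasurePreserving_snd.ae (ae_hazardMeasure_cumHazard_nonneg (τ := τ) hlam)]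
    with p hp1 hp2
  refine ⟨mul_nonneg (D.Y_nonneg _ _ _) (hazardFactor_nonneg j _ hp2 β γ), ?_⟩
  have h1 := abs_hazardFactor_sub_le_of_norm_le j (hp1 i) hp2 β γ
  have h2 := mul_le_mul_of_nonneg_left h1 (D.Y_nonneg i p.2 p.1)
  simp only [relativeIntensity, riskTerm, Pi.one_apply, mul_one]
  rw [← mul_sub, abs_mul, abs_of_nonneg (D.Y_nonneg i p.2 p.1)]
  exact h2.trans (le_of_eq (by ring))

theorem integral_riskSum_eq (hn : n ≠ 0) (P : Measure Ω) (φ : EuclideanSpace ℝ (Fin m) → ℝ)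
    (β : EuclideanSpace ℝ (Fin m)) (u : ℝ) :
    ∫ ω, D.riskSum φ β u ω ∂P = n * D.meanRiskSum P φ β u := by
  rw [meanRiskSum, mul_div_cancel₀]
  exact_mod_cast hn

/-- The proportional intensities of the units add up to S⁽⁰⁾, whose expectation is n s⁽⁰⁾; the local
alternative costs the factor 1 + r. The useful choice is ψ = 1/s⁽⁰⁾, which leaves only the total
mass of μ. -/
theorem sum_lintegral_failureEvent_le (hn : n ≠ 0) (hr : 0 ≤ r)
    (hlaw : D.HasFailureLaw P τ μ β r)
    (hz : ∀ᵐ ω ∂P, ∀ k, ‖D.z k ω‖ ≤ K) {ψ : ℝ → ℝ≥0∞} (hψ : Measurable ψ) :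
    ∑ i, ∫⁻ ω in D.failureEvent i τ, ψ (D.X i ω).toReal ∂P ≤
      ENNReal.ofReal (1 + r) * ∫⁻ u, ψ u * ENNReal.ofReal (n * D.meanRiskSum P 1 β u) ∂μ := by
  have hmR : ∀ i, Measurable fun p : Ω × ℝ => ENNReal.ofReal (D.riskTerm 1 β i p.2 p.1) * ψ p.2 :=
    fun i => (D.measurable_riskTerm measurable_one i).ennreal_ofReal.mul (hψ.comp measurable_snd)
  have hstep : ∀ i, ∫⁻ ω in D.failureEvent i τ, ψ (D.X i ω).toReal ∂P ≤
      ENNReal.ofReal (1 + r) *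
        ∫⁻ u, (∫⁻ ω, ENNReal.ofReal (D.riskTerm 1 β i u ω) ∂P) * ψ u ∂μ := fun i => by
    obtain ⟨R, hRm, hR, hmap⟩ := hlaw i
    have hm1 : Measurable fun ω => (D.z i ω, (D.X i ω).toReal) :=
      (D.measurable_z i).prodMk (D.measurable_X i).ennreal_toReal
    have hm2 : Measurable fun p : Ω × ℝ => (D.z i p.1, p.2) :=
      ((D.measurable_z i).comp measurable_fst).prodMk measurable_snd
    have hψ2 : Measurable fun x : EuclideanSpace ℝ (Fin m) × ℝ => ψ x.2 := hψ.comp measurable_snd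
    have h1 : ∫⁻ ω in D.failureEvent i τ, ψ (D.X i ω).toReal ∂P =
        ∫⁻ p, ENNReal.ofReal (R p) * ψ p.2 ∂(P.prod μ) := by
      have := lintegral_map (μ := P.restrict (D.failureEvent i τ)) hψ2 hm1
      have hψ3 : Measurable fun p : Ω × ℝ => ψ p.2 := hψ.comp measurable_snd
      rw [hmap, lintegral_map hψ2 hm2] at this
      refine this.symm.trans ?_
      exact lintegral_withDensity_eq_lintegral_mul₀ hRm.ennreal_ofReal hψ3.aemeasurable
    rw [h1]
    calc ∫⁻ p, ENNReal.ofReal (R p) * ψ p.2 ∂(P.prod μ)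
        ≤ ∫⁻ p, ENNReal.ofReal (1 + r) *
            (ENNReal.ofReal (D.riskTerm 1 β i p.2 p.1) * ψ p.2) ∂(P.prod μ) := by
          refine lintegral_mono_ae ?_
          filter_upwards [hR] with p hp
          rw [← mul_assoc, ← ENNReal.ofReal_mul (by linarith)]
          refine mul_le_mul_left (ENNReal.ofReal_le_ofReal ?_) _
          have := le_of_abs_le hp.2
          linarith
      _ = _ := by
          rw [lintegral_const_mul _ (hmR i), lintegral_prod_symm _ (hmR i).aemeasurable]
          congr 1
          refine lintegral_congr fun u => ?_
          exact lintegral_mul_const (μ := P) (ψ u)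
            (D.measurable_riskTerm_apply (β := β) measurable_one i u).ennreal_ofReal
  refine (Finset.sum_le_sum fun i _ => hstep i).trans (le_of_eq ?_)
  rw [← Finset.mul_sum, ← lintegral_finsetSum]
  · congr 1
    refine lintegral_congr fun u => ?_
    rw [← Finset.sum_mul, mul_comm]
    congr 1
    rw [← D.integral_riskSum_eq hn, ofReal_integral_eq_lintegral_ofReal
      (D.integrable_riskSum_one hz u) (Eventually.of_forall fun ω => D.riskSum_one_nonneg u ω),
      ← lintegral_finsetSum]
    · refine lintegral_congr fun ω => ?_
      rw [riskSum, ENNReal.ofReal_sum_of_nonneg fun i _ => D.riskTerm_one_nonneg i u ω]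
    · exact fun i _ =>
        (D.measurable_riskTerm_apply measurable_one i u).ennreal_ofReal
  · exact fun i _ =>
      (D.measurable_riskTerm measurable_one i).ennreal_ofReal.lintegral_prod_left'.mul hψ

theorem N_eq_indicator (i : Fin n) (τ : ℝ) :
    D.N i τ = Set.indicator (D.failureEvent i τ) 1 := rfl

theorem ofReal_N_mul (i : Fin n) (τ : ℝ) (f : Ω → ℝ) (ω : Ω) :
    ENNReal.ofReal (D.N i τ ω * f ω) =
      Set.indicator (D.failureEvent i τ) (fun ω => ENNReal.ofReal (f ω)) ω := by
  rw [N_eq_indicator]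
  by_cases h : ω ∈ D.failureEvent i τ <;> simp [h]

/-- The averages over the risk sets at the failure times are close to the population averages. -/
theorem lintegral_sum_abs_riskRatio_sub_le (hn : n ≠ 0) (hr : 0 ≤ r) (hM : 0 < M)
    (hlaw : D.HasFailureLaw P τ μ β r) (hind : iIndepFun D.obs P)
    (hz : ∀ᵐ ω ∂P, ∀ k, ‖D.z k ω‖ ≤ K) (hφ : Measurable φ) (hφK : ∀ z, ‖z‖ ≤ K → |φ z| ≤ M) :
    ∫⁻ ω, ENNReal.ofReal (∑ i, D.N i τ ω *
        |D.riskRatio φ β (D.X i ω).toReal ω - D.meanRiskRatio P φ β (D.X i ω).toReal|) ∂P ≤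
      ENNReal.ofReal (M * (6 * Real.exp (‖β‖ * K) * (1 + r) * √n * μ.real Set.univ)) := by
  set W := Real.exp (‖β‖ * K) with hW
  have hWpos : 0 < W := Real.exp_pos _
  have hnpos : (0 : ℝ) < n := by exact_mod_cast Nat.pos_of_ne_zero hn
  have h1n : 1 ≤ √(n : ℝ) := Real.one_le_sqrt.2 (by exact_mod_cast Nat.one_le_iff_ne_zero.2 hn)
  -- The weight 1/s⁽⁰⁾, with value ∞ where s⁽⁰⁾ vanishes.
  set ψ : ℝ → ℝ≥0∞ := fun u => (ENNReal.ofReal (D.meanRiskSum P 1 β u))⁻¹ with hψdef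
  have hψ : Measurable ψ := (D.measurable_meanRiskSum measurable_one).ennreal_ofReal.inv
  have hX : ∀ i, Measurable fun ω => (D.X i ω).toReal := fun i => (D.measurable_X i).ennreal_toReal
  have hψX : ∀ i, Measurable fun ω => ψ (D.X i ω).toReal := fun i => hψ.comp (hX i)
  have hone : ∀ z : EuclideanSpace ℝ (Fin m), ‖z‖ ≤ K →
    |(1 : EuclideanSpace ℝ (Fin m) → ℝ) z| ≤ 1 := fun _ _ => (abs_one (α := ℝ)).le
  have hcm : ∀ {χ : EuclideanSpace ℝ (Fin m) → ℝ}, Measurable χ → ∀ i,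
      Measurable fun ω => |D.centeredRiskSum P χ β i (D.X i ω).toReal ω| := fun {χ} hχ i =>
    (D.measurable_centeredRiskSum_comp hχ i (hX i)).abs
  have hpt : ∀ᵐ ω ∂P, ∀ i u,
      ENNReal.ofReal |D.riskRatio φ β u ω - D.meanRiskRatio P φ β u| ≤
        ψ u * ENNReal.ofReal (4 * (W * M) / n) +
          (ψ u * ENNReal.ofReal |D.centeredRiskSum P φ β i u ω| * ENNReal.ofReal (1 / n) +
           ψ u * ENNReal.ofReal |D.centeredRiskSum P 1 β i u ω| * ENNReal.ofReal (M / n)) := by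
    filter_upwards [hz] with ω hω i u
    have h1 := D.meanRiskSum_mul_abs_riskRatio_sub_le (P := P) (β := β) hM.le hφK hz hω u
    have h2 := D.abs_riskSum_div_sub_meanRiskSum_le (P := P) (β := β) hM.le hφ hφK hz hω i u
    have h3 := D.abs_riskSum_div_sub_meanRiskSum_le (P := P) (β := β) zero_le_one
      measurable_one hone hz hω i u
    set x := |D.riskRatio φ β u ω - D.meanRiskRatio P φ β u| with hx
    set a := |D.centeredRiskSum P φ β i u ω| with ha
    set b := |D.centeredRiskSum P 1 β i u ω| with hb
    have ha0 : 0 ≤ a := abs_nonneg _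
    have hb0 : 0 ≤ b := abs_nonneg _
    -- The 4 collects the cost of setting aside unit i, 2 for φ and 2 for the denominator. This term
    -- also makes B strictly positive, so that ∞ · B = ∞ settles the case s⁽⁰⁾ = 0.
    set B := 4 * (W * M) / n + (a * (1 / n) + b * (M / n)) with hB
    have h4 : D.meanRiskSum P 1 β u * x ≤ B := by
      refine h1.trans ((add_le_add h2 (mul_le_mul_of_nonneg_left h3 hM.le)).trans (le_of_eq ?_))
      rw [hB]; field_simp; ring
    have hBpos : 0 < B := by positivity
    have h5 : ENNReal.ofReal x ≤ ψ u * ENNReal.ofReal B := by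
      rcases (D.meanRiskSum_one_nonneg P β u).eq_or_lt with h0 | h0
      · rw [hψdef]
        simp only
        rw [← h0, ENNReal.ofReal_zero, ENNReal.inv_zero, ENNReal.top_mul (by simpa using hBpos)]
        exact le_top
      · rw [hψdef]
        simp only
        rw [← ENNReal.ofReal_inv_of_pos h0, ← ENNReal.ofReal_mul (inv_nonneg.2 h0.le)]
        refine ENNReal.ofReal_le_ofReal ?_
        rwa [inv_mul_eq_div, le_div_iff₀ h0, mul_comm]
    refine h5.trans (le_of_eq ?_)
    rw [hB, ENNReal.ofReal_add (by positivity) (by positivity),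
      ENNReal.ofReal_add (by positivity) (by positivity), ENNReal.ofReal_mul ha0,
      ENNReal.ofReal_mul hb0]
    ring
  have hi : ∀ i, ∫⁻ ω in D.failureEvent i τ,
        ENNReal.ofReal |D.riskRatio φ β (D.X i ω).toReal ω -
          D.meanRiskRatio P φ β (D.X i ω).toReal| ∂P ≤
      ENNReal.ofReal (6 * W * M * √n / n) *
        ∫⁻ ω in D.failureEvent i τ, ψ (D.X i ω).toReal ∂P := fun i => by
    set I := ∫⁻ ω in D.failureEvent i τ, ψ (D.X i ω).toReal ∂P with hI
    have h1 := D.lintegral_centeredRiskSum_le (β := β) hM.le hφ hφK hz hind i τ hψ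
    have h2 := D.lintegral_centeredRiskSum_le (β := β) zero_le_one measurable_one hone hz hind i τ hψ
    have hm : ∀ {χ : EuclideanSpace ℝ (Fin m) → ℝ}, Measurable χ → Measurable fun ω =>
        ψ (D.X i ω).toReal * ENNReal.ofReal |D.centeredRiskSum P χ β i (D.X i ω).toReal ω| :=
      fun {χ} hχ => (hψX i).mul (hcm hχ i).ennreal_ofReal
    calc _ ≤ ∫⁻ ω in D.failureEvent i τ, (ψ (D.X i ω).toReal * ENNReal.ofReal (4 * (W * M) / n) +
          (ψ (D.X i ω).toReal * ENNReal.ofReal |D.centeredRiskSum P φ β i (D.X i ω).toReal ω| *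
              ENNReal.ofReal (1 / n) +
           ψ (D.X i ω).toReal * ENNReal.ofReal |D.centeredRiskSum P 1 β i (D.X i ω).toReal ω| *
              ENNReal.ofReal (M / n))) ∂P :=
          lintegral_mono_ae (ae_restrict_of_ae (hpt.mono fun ω h => h i _))
      _ ≤ I * ENNReal.ofReal (4 * (W * M) / n) +
          (ENNReal.ofReal (√n * (W * M)) * I * ENNReal.ofReal (1 / n) +
           ENNReal.ofReal (√n * (W * 1)) * I * ENNReal.ofReal (M / n)) := by
          rw [lintegral_add_left ((hψX i).mul_const _), lintegral_mul_const _ (hψX i),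
            lintegral_add_left ((hm hφ).mul_const _), lintegral_mul_const _ (hm hφ),
            lintegral_mul_const _ (hm measurable_one)]
          gcongr
      _ = ENNReal.ofReal (4 * (W * M) / n + (√n * (W * M) * (1 / n) + √n * (W * 1) * (M / n))) * I := by
          rw [ENNReal.ofReal_add (by positivity) (by positivity),
            ENNReal.ofReal_add (by positivity) (by positivity),
            ENNReal.ofReal_mul (by positivity : 0 ≤ √(n : ℝ) * (W * M)),
            ENNReal.ofReal_mul (by positivity : 0 ≤ √(n : ℝ) * (W * 1))]
          ring
      _ ≤ _ := by
          refine mul_le_mul_left (ENNReal.ofReal_le_ofReal ?_) _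
          -- Since 1 ≤ √n, the bounded terms join the two fluctuation terms: 4 + 1 + 1 = 6.
          have h3 : 4 * (W * M) ≤ 4 * (W * M) * √n := le_mul_of_one_le_right (by positivity) h1n
          have h4 : 4 * (W * M) / n + (√n * (W * M) * (1 / n) + √n * (W * 1) * (M / n)) =
            (4 * (W * M) + 2 * (W * M) * √n) / n := by field_simp; ring
          rw [h4]
          refine div_le_div_of_nonneg_right ?_ hnpos.le
          linarith
  have hsum : ∫⁻ ω, ENNReal.ofReal (∑ i, D.N i τ ω *
        |D.riskRatio φ β (D.X i ω).toReal ω - D.meanRiskRatio P φ β (D.X i ω).toReal|) ∂P =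
      ∑ i, ∫⁻ ω in D.failureEvent i τ, ENNReal.ofReal |D.riskRatio φ β (D.X i ω).toReal ω -
          D.meanRiskRatio P φ β (D.X i ω).toReal| ∂P := by
    have hm : ∀ i, Measurable fun ω => ENNReal.ofReal |D.riskRatio φ β (D.X i ω).toReal ω -
          D.meanRiskRatio P φ β (D.X i ω).toReal| := fun i =>
      ((D.measurable_riskRatio_comp (β := β) hφ (hX i)).sub
        ((D.measurable_meanRiskRatio (P := P) (β := β) hφ).comp (hX i))).abs.ennreal_ofReal
    simp only [← lintegral_indicator (D.measurableSet_failureEvent _ τ)]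
    rw [← lintegral_finsetSum _ fun i _ => (hm i).indicator (D.measurableSet_failureEvent i τ)]
    refine lintegral_congr fun ω => ?_
    rw [ENNReal.ofReal_sum_of_nonneg fun i _ => mul_nonneg (D.N_nonneg i τ ω) (abs_nonneg _)]
    exact Finset.sum_congr rfl fun i _ => D.ofReal_N_mul i τ (fun ω =>
      |D.riskRatio φ β (D.X i ω).toReal ω - D.meanRiskRatio P φ β (D.X i ω).toReal|) ω
  rw [hsum]
  calc _ ≤ ∑ i, ENNReal.ofReal (6 * W * M * √n / n) *
        ∫⁻ ω in D.failureEvent i τ, ψ (D.X i ω).toReal ∂P := Finset.sum_le_sum fun i _ => hi i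
    _ ≤ ENNReal.ofReal (6 * W * M * √n / n) * (ENNReal.ofReal (1 + r) *
        ∫⁻ u, ψ u * ENNReal.ofReal (n * D.meanRiskSum P 1 β u) ∂μ) := by
        rw [← Finset.mul_sum]
        exact mul_le_mul_right (D.sum_lintegral_failureEvent_le hn hr hlaw hz hψ) _
    _ ≤ ENNReal.ofReal (6 * W * M * √n / n) * (ENNReal.ofReal (1 + r) *
        ∫⁻ _, ENNReal.ofReal n ∂μ) := by
        gcongr with u
        -- The cancellation: the weight 1/s⁽⁰⁾ meets the factor s⁽⁰⁾ of the intensity, and their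
        -- product is at most 1 even where s⁽⁰⁾ = 0.
        rw [ENNReal.ofReal_mul hnpos.le, mul_left_comm]
        exact mul_le_of_le_one_right (zero_le) (ENNReal.inv_mul_le_one _)
    _ = _ := by
        rw [lintegral_const, ← ofReal_measureReal, ← ENNReal.ofReal_mul hnpos.le,
          ← ENNReal.ofReal_mul (by linarith), ← ENNReal.ofReal_mul (by positivity)]
        congr 1
        field_simp

/-- Bias of the local alternative for one unit: the true density and the proportional one differ by
at most r exp(‖β‖K), over a space of total mass μ(ℝ). -/
theorem abs_integral_N_mul_sub_le (hr : 0 ≤ r) (hM : 0 ≤ M)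
    (hlaw : D.HasFailureLaw P τ μ β r) (hz : ∀ᵐ ω ∂P, ∀ k, ‖D.z k ω‖ ≤ K)
    {F : EuclideanSpace ℝ (Fin m) × ℝ → ℝ} (hF : Measurable F)
    (hFK : ∀ z u, ‖z‖ ≤ K → |F (z, u)| ≤ M) (i : Fin n) :
    |∫ ω, D.N i τ ω * F (D.z i ω, (D.X i ω).toReal) ∂P -
        ∫ p, F (D.z i p.1, p.2) * D.riskTerm 1 β i p.2 p.1 ∂(P.prod μ)| ≤
      r * Real.exp (‖β‖ * K) * μ.real Set.univ * M := by
  obtain ⟨R, hRm, hR, hmap⟩ := hlaw i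
  have hm1 : Measurable fun ω => (D.z i ω, (D.X i ω).toReal) :=
    (D.measurable_z i).prodMk (D.measurable_X i).ennreal_toReal
  have hm2 : Measurable fun p : Ω × ℝ => (D.z i p.1, p.2) :=
    ((D.measurable_z i).comp measurable_fst).prodMk measurable_snd
  have hF2 : Measurable fun p : Ω × ℝ => F (D.z i p.1, p.2) := hF.comp hm2
  have hz2 := Measure.quasiMeasurePreserving_fst (μ := P) (ν := μ) |>.ae hz
  have h1 : ∫ ω, D.N i τ ω * F (D.z i ω, (D.X i ω).toReal) ∂P =
      ∫ p, R p * F (D.z i p.1, p.2) ∂(P.prod μ) := by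
    have e1 : ∫ ω, D.N i τ ω * F (D.z i ω, (D.X i ω).toReal) ∂P =
        ∫ ω in D.failureEvent i τ, F (D.z i ω, (D.X i ω).toReal) ∂P := by
      rw [← integral_indicator (D.measurableSet_failureEvent i τ)]
      refine integral_congr_ae (Eventually.of_forall fun ω => ?_)
      simp only [N_eq_indicator]
      by_cases h : ω ∈ D.failureEvent i τ <;> simp [h]
    have e2 := integral_map (μ := P.restrict (D.failureEvent i τ)) hm1.aemeasurable
      hF.aestronglyMeasurable
    rw [hmap, integral_map hm2.aemeasurable hF.aestronglyMeasurable,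
      integral_withDensity_eq_integral_toReal_smul₀ hRm.ennreal_ofReal
        (Eventually.of_forall fun _ => ENNReal.ofReal_lt_top)] at e2
    rw [e1, ← e2]
    refine integral_congr_ae ?_
    filter_upwards [hR] with p hp
    rw [ENNReal.toReal_ofReal hp.1, smul_eq_mul]
  have hq : Measurable fun p : Ω × ℝ => D.riskTerm 1 β i p.2 p.1 :=
    D.measurable_riskTerm measurable_one i
  have hint : Integrable (fun p : Ω × ℝ => F (D.z i p.1, p.2) * D.riskTerm 1 β i p.2 p.1)
      (P.prod μ) := by
    refine Integrable.of_bound (hF2.mul hq).aestronglyMeasurable (M * Real.exp (‖β‖ * K)) ?_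
    filter_upwards [hz2] with p hp
    rw [norm_mul, Real.norm_eq_abs, Real.norm_of_nonneg (D.riskTerm_one_nonneg i p.2 p.1)]
    exact mul_le_mul (hFK _ _ (hp i)) (D.riskTerm_one_le hp i p.2)
      (D.riskTerm_one_nonneg i p.2 p.1) hM
  have hdb : ∀ᵐ p ∂(P.prod μ), ‖(R p - D.riskTerm 1 β i p.2 p.1) * F (D.z i p.1, p.2)‖ ≤
      r * Real.exp (‖β‖ * K) * M := by
    filter_upwards [hz2, hR] with p hp hRp
    rw [norm_mul, Real.norm_eq_abs, Real.norm_eq_abs]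
    refine mul_le_mul (hRp.2.trans (mul_le_mul_of_nonneg_left (D.riskTerm_one_le hp i p.2) hr))
      (hFK _ _ (hp i)) (abs_nonneg _) (by positivity)
  have hdint : Integrable (fun p => (R p - D.riskTerm 1 β i p.2 p.1) * F (D.z i p.1, p.2))
      (P.prod μ) := Integrable.of_bound
    ((hRm.sub hq.aemeasurable).mul hF2.aemeasurable).aestronglyMeasurable _ hdb
  have hRint : Integrable (fun p => R p * F (D.z i p.1, p.2)) (P.prod μ) := by
    refine (hdint.add hint).congr (Eventually.of_forall fun p => ?_)
    simp only [Pi.add_apply]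
    ring
  rw [h1, ← integral_sub hRint hint]
  have h3 := norm_integral_le_of_norm_le_const hdb
  rw [Real.norm_eq_abs] at h3
  refine le_trans (le_of_eq ?_) (h3.trans (le_of_eq ?_))
  · congr 1
    refine integral_congr_ae (Eventually.of_forall fun p => ?_)
    simp only
    ring
  · rw [measureReal_def, ← Set.univ_prod_univ, Measure.prod_prod, measure_univ, one_mul,
      ← measureReal_def]
    ring

/-- A law of large numbers for sums over the observed failures. -/
theorem lintegral_abs_sum_N_mul_sub_le (hn : n ≠ 0) (hr : 0 ≤ r) (hM : 0 ≤ M) {M' : ℝ}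
    (hM' : 0 ≤ M') (hlaw : D.HasFailureLaw P τ μ β r) (hind : iIndepFun D.obs P)
    (hz : ∀ᵐ ω ∂P, ∀ k, ‖D.z k ω‖ ≤ K) (hφ : Measurable φ) (hφK : ∀ z, ‖z‖ ≤ K → |φ z| ≤ M)
    {f : ℝ → ℝ} (hf : Measurable f) (hfM : ∀ u, |f u| ≤ M') :
    ∫⁻ ω, ENNReal.ofReal |∑ i, D.N i τ ω * (φ (D.z i ω) * f (D.X i ω).toReal) -
        n * ∫ u, f u * D.meanRiskSum P φ β u ∂μ| ∂P ≤
      ENNReal.ofReal (M * M' * (√n + n * (r * Real.exp (‖β‖ * K) * μ.real Set.univ))) := by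
  have hobs : ∀ k, Measurable (D.obs k) := fun k =>
    (D.measurable_X k).prodMk ((D.measurable_δ k).prodMk (D.measurable_z k))
  have hF : Measurable fun p : EuclideanSpace ℝ (Fin m) × ℝ => φ p.1 * f p.2 :=
    (hφ.comp measurable_fst).mul (hf.comp measurable_snd)
  have hFK : ∀ (z : EuclideanSpace ℝ (Fin m)) (u : ℝ), ‖z‖ ≤ K → |φ z * f u| ≤ M * M' :=
    fun z u h => by
      rw [abs_mul]; exact mul_le_mul (hφK z h) (hfM u) (abs_nonneg _) hM
  have hMM : 0 ≤ M * M' := mul_nonneg hM hM'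
  set ξ : Fin n → Ω → ℝ := fun i ω => D.N i τ ω * (φ (D.z i ω) * f (D.X i ω).toReal) with hξ
  have hG : Measurable fun o : ℝ≥0∞ × ℝ × EuclideanSpace ℝ (Fin m) =>
      Set.indicator {x : ℝ≥0∞ × ℝ × EuclideanSpace ℝ (Fin m) |
        x.1 ≤ ENNReal.ofReal τ ∧ x.2.1 = 1} (1 : ℝ≥0∞ × ℝ × EuclideanSpace ℝ (Fin m) → ℝ) o * (φ o.2.2 * f o.1.toReal) := by
    have h1 : MeasurableSet {x : ℝ≥0∞ × ℝ × EuclideanSpace ℝ (Fin m) |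
        x.1 ≤ ENNReal.ofReal τ ∧ x.2.1 = 1} :=
      (measurableSet_le measurable_fst measurable_const).inter
        ((measurable_fst.comp measurable_snd) (measurableSet_singleton (1 : ℝ)))
    exact (measurable_one.indicator h1).mul
      ((hφ.comp (measurable_snd.comp measurable_snd)).mul
        (hf.comp measurable_fst.ennreal_toReal))
  have hξm : ∀ i, Measurable (ξ i) := fun i => hG.comp (hobs i)
  have hξi : iIndepFun ξ P := hind.comp _ fun _ => hG
  have hξb : ∀ i, ∀ᵐ ω ∂P, |ξ i ω| ≤ M * M' := fun i => by
    filter_upwards [hz] with ω hω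
    rw [hξ]
    simp only
    rw [abs_mul, abs_of_nonneg (D.N_nonneg i τ ω)]
    exact (mul_le_of_le_one_left (abs_nonneg _) (D.N_le_one i τ ω)).trans (hFK _ _ (hω i))
  have hlln := lintegral_abs_sum_sub_integral_le hMM hξi hξm hξb Finset.univ
  rw [Fintype.card_fin] at hlln
  have hz2 := Measure.quasiMeasurePreserving_fst (μ := P) (ν := μ) |>.ae hz
  have hterm : ∀ i, ∫ p, (φ (D.z i p.1) * f p.2) * D.riskTerm 1 β i p.2 p.1 ∂(P.prod μ) =
      ∫ u, f u * ∫ ω, D.riskTerm φ β i u ω ∂P ∂μ := fun i => by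
    have e1 : ∀ p : Ω × ℝ, (φ (D.z i p.1) * f p.2) * D.riskTerm 1 β i p.2 p.1 =
        f p.2 * D.riskTerm φ β i p.2 p.1 := fun p => by rw [D.riskTerm_eq_mul (φ := φ)]; ring
    simp only [e1]
    rw [integral_prod_symm]
    · simp only [integral_const_mul]
    · refine Integrable.of_bound ((hf.comp measurable_snd).mul
        (D.measurable_riskTerm hφ i)).aestronglyMeasurable (M' * (Real.exp (‖β‖ * K) * M)) ?_
      filter_upwards [hz2] with p hp
      rw [norm_mul]
      exact mul_le_mul (hfM _) (D.abs_riskTerm_le hM hφK hp i _) (norm_nonneg _) hM'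
  have hmean : ∑ i, ∫ u, f u * ∫ ω, D.riskTerm φ β i u ω ∂P ∂μ =
      n * ∫ u, f u * D.meanRiskSum P φ β u ∂μ := by
    rw [← integral_const_mul, ← integral_finsetSum]
    · refine integral_congr_ae (Eventually.of_forall fun u => ?_)
      simp only
      rw [← Finset.mul_sum, ← integral_finsetSum _ fun k _ => D.integrable_riskTerm hφ hφK hM hz k u,
        mul_left_comm, ← D.integral_riskSum_eq hn]
      rfl
    · intro i _
      refine Integrable.of_bound
        (hf.mul (D.measurable_integral_riskTerm hφ i)).aestronglyMeasurable
        (M' * (Real.exp (‖β‖ * K) * M)) (Eventually.of_forall fun u => ?_)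
      rw [norm_mul]
      refine mul_le_mul (hfM _) ?_ (norm_nonneg _) hM'
      have := norm_integral_le_of_norm_le_const (μ := P) (f := D.riskTerm φ β i u)
        (hz.mono fun ω' h => D.abs_riskTerm_le (β := β) hM hφK h i u)
      simpa using this
  -- Independence controls only the fluctuations about the true means. Each mean is off by the bias
  -- of one unit, whence the factor n, which is harmless only because r → 0.
  have hbias : |∑ i, ∫ ω, ξ i ω ∂P - n * ∫ u, f u * D.meanRiskSum P φ β u ∂μ| ≤
      n * (r * Real.exp (‖β‖ * K) * μ.real Set.univ * (M * M')) := by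
    rw [← hmean, ← Finset.sum_sub_distrib]
    refine (Finset.abs_sum_le_sum_abs _ _).trans ?_
    refine (Finset.sum_le_sum fun i _ => (?_ : _ ≤
      r * Real.exp (‖β‖ * K) * μ.real Set.univ * (M * M'))).trans (by simp)
    rw [← hterm i]
    exact D.abs_integral_N_mul_sub_le hr hMM hlaw hz hF hFK i
  set b := n * (r * Real.exp (‖β‖ * K) * μ.real Set.univ * (M * M')) with hb
  have hb0 : 0 ≤ b := (abs_nonneg _).trans hbias
  calc _ ≤ ∫⁻ ω, (ENNReal.ofReal |∑ i, (ξ i ω - ∫ ω', ξ i ω' ∂P)| + ENNReal.ofReal b) ∂P := by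
        refine lintegral_mono fun ω => ?_
        rw [← ENNReal.ofReal_add (abs_nonneg _) hb0]
        refine ENNReal.ofReal_le_ofReal ?_
        refine le_trans (le_of_eq ?_) ((abs_add_le (∑ i, (ξ i ω - ∫ ω', ξ i ω' ∂P))
          (∑ i, ∫ ω, ξ i ω ∂P - n * ∫ u, f u * D.meanRiskSum P φ β u ∂μ)).trans
            (add_le_add_right hbias _))
        congr 1
        rw [Finset.sum_sub_distrib]
        ring
    _ ≤ ENNReal.ofReal (√n * (M * M')) + ENNReal.ofReal b := by
        rw [lintegral_add_right _ measurable_const, lintegral_const, measure_univ, mul_one]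
        gcongr
    _ = _ := by
        rw [← ENNReal.ofReal_add (by positivity) hb0]
        congr 1
        rw [hb]; ring

end SurvivalSample

/-- The order of the errors in the laws of large numbers for sums over the observed failures. -/
noncomputable def failureSumError (W L r : ℝ) (n : ℕ) : ℝ :=
  √n + n * (r * W * L) + 6 * W * (1 + r) * √n * L

/-! ### The score and the estimated information at the true parameter -/

namespace SurvivalSample

variable {m n : ℕ} {Ω : Type*} [mΩ : MeasurableSpace Ω] (D : SurvivalSample m n Ω)

/-- The estimated information matrix at time `τ`, entry by entry. -/
noncomputable def infoEstimate (τ : ℝ) (β : EuclideanSpace ℝ (Fin m)) (a b : Fin m) (ω : Ω) : ℝ :=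
  ∑ i, D.N i τ ω * (D.riskRatio (fun z => z a * z b) β (D.X i ω).toReal ω -
    D.riskRatio (fun z => z a) β (D.X i ω).toReal ω *
      D.riskRatio (fun z => z b) β (D.X i ω).toReal ω)

theorem score_apply (τ : ℝ) (β : EuclideanSpace ℝ (Fin m)) (ω : Ω) (a : Fin m) :
    D.score τ β ω a =
      ∑ i, D.N i τ ω * (D.z i ω a - D.riskRatio (fun z => z a) β (D.X i ω).toReal ω) := by
  simp only [score, E, S0, S1, riskRatio, riskSum, riskTerm, WithLp.ofLp_sum, Finset.sum_apply,
    PiLp.smul_apply, PiLp.sub_apply, smul_eq_mul, Pi.one_apply, mul_one, div_eq_inv_mul]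

variable {P : Measure Ω} [IsProbabilityMeasure P] {K M r τ : ℝ} {μ : Measure ℝ} [IsFiniteMeasure μ]
  {φ : EuclideanSpace ℝ (Fin m) → ℝ} {β : EuclideanSpace ℝ (Fin m)}

/-- The entries of the population covariance matrix over the risk set. -/
noncomputable def meanRiskCov (P : Measure Ω) (β : EuclideanSpace ℝ (Fin m)) (a b : Fin m)
    (u : ℝ) : ℝ :=
  D.meanRiskRatio P (fun z => z a * z b) β u -
    D.meanRiskRatio P (fun z => z a) β u * D.meanRiskRatio P (fun z => z b) β u

theorem measurable_coord (a : Fin m) : Measurable fun z : EuclideanSpace ℝ (Fin m) => z a := by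
  fun_prop

theorem measurable_coord_mul (a b : Fin m) :
    Measurable fun z : EuclideanSpace ℝ (Fin m) => z a * z b := by
  fun_prop

theorem abs_coord_le (a : Fin m) (z : EuclideanSpace ℝ (Fin m)) (hz : ‖z‖ ≤ K) : |z a| ≤ K :=
  (PiLp.norm_apply_le z a).trans hz

theorem abs_coord_mul_le (a b : Fin m) (z : EuclideanSpace ℝ (Fin m)) (hz : ‖z‖ ≤ K) :
    |z a * z b| ≤ K ^ 2 := by
  rw [abs_mul, pow_two]
  exact mul_le_mul (abs_coord_le a z hz) (abs_coord_le b z hz) (abs_nonneg _)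
    ((norm_nonneg z).trans hz)

theorem measurable_failureTime (i : Fin n) : Measurable fun ω => (D.X i ω).toReal :=
  (D.measurable_X i).ennreal_toReal

theorem measurable_score_apply (τ : ℝ) (β : EuclideanSpace ℝ (Fin m)) (a : Fin m) :
    Measurable fun ω => D.score τ β ω a := by
  simp only [score_apply]
  exact Finset.measurable_sum _ fun i _ => (D.measurable_N i τ).mul
    (((measurable_coord a).comp (D.measurable_z i)).sub
      (D.measurable_riskRatio_comp (measurable_coord a) (D.measurable_failureTime i)))

theorem measurable_infoEstimate (τ : ℝ) (β : EuclideanSpace ℝ (Fin m)) (a b : Fin m) :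
    Measurable (D.infoEstimate τ β a b) :=
  Finset.measurable_sum _ fun i _ => (D.measurable_N i τ).mul
    ((D.measurable_riskRatio_comp (measurable_coord_mul a b) (D.measurable_failureTime i)).sub
      ((D.measurable_riskRatio_comp (measurable_coord a) (D.measurable_failureTime i)).mul
        (D.measurable_riskRatio_comp (measurable_coord b) (D.measurable_failureTime i))))

theorem measurable_sum_abs_riskRatio_sub (hφ : Measurable φ) (τ : ℝ)
    (β : EuclideanSpace ℝ (Fin m)) :
    Measurable fun ω => ∑ i, D.N i τ ω *
      |D.riskRatio φ β (D.X i ω).toReal ω - D.meanRiskRatio P φ β (D.X i ω).toReal| :=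
  Finset.measurable_sum _ fun i _ => (D.measurable_N i τ).mul
    ((D.measurable_riskRatio_comp hφ (D.measurable_failureTime i)).sub
      ((D.measurable_meanRiskRatio (P := P) hφ).comp (D.measurable_failureTime i))).abs

theorem measurable_sum_N_mul (hφ : Measurable φ) (τ : ℝ) {f : ℝ → ℝ} (hf : Measurable f) (c : ℝ) :
    Measurable fun ω => |∑ i, D.N i τ ω * (φ (D.z i ω) * f (D.X i ω).toReal) - c| :=
  ((Finset.measurable_sum _ fun i _ => (D.measurable_N i τ).mul
    ((hφ.comp (D.measurable_z i)).mul (hf.comp (D.measurable_failureTime i)))).sub_const c).abs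

/-- Write the score as ∑ N z - ∑ N e - ∑ N (E - e), with e the population mean over the risk set.
The first two sums have the same centre c and the third is small, so the score is negligible against
n. -/
theorem lintegral_abs_score_le (hn : n ≠ 0) (hr : 0 ≤ r) (hK : 0 < K)
    (hlaw : D.HasFailureLaw P τ μ β r) (hind : iIndepFun D.obs P)
    (hz : ∀ᵐ ω ∂P, ∀ k, ‖D.z k ω‖ ≤ K) (a : Fin m) :
    ∫⁻ ω, ENNReal.ofReal |D.score τ β ω a| ∂P ≤ ENNReal.ofReal
      (2 * K * failureSumError (Real.exp (‖β‖ * K)) (μ.real Set.univ) r n) := by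
  have hone : ∀ z : EuclideanSpace ℝ (Fin m), ‖z‖ ≤ K →
    |(1 : EuclideanSpace ℝ (Fin m) → ℝ) z| ≤ 1 := fun _ _ => (abs_one (α := ℝ)).le
  set c := (n : ℝ) * ∫ u, D.meanRiskSum P (fun z => z a) β u ∂μ with hc
  have h1 := D.lintegral_abs_sum_N_mul_sub_le hn hr hK.le zero_le_one hlaw hind hz
    (measurable_coord a) (abs_coord_le a) (f := fun _ => 1) measurable_const
    (fun _ => (abs_one (α := ℝ)).le)
  have h2 := D.lintegral_abs_sum_N_mul_sub_le hn hr zero_le_one hK.le hlaw hind hz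
    measurable_one hone (f := D.meanRiskRatio P (fun z => z a) β)
    (D.measurable_meanRiskRatio (measurable_coord a))
    (D.abs_meanRiskRatio_le hK.le (abs_coord_le a) hz)
  have h3 := D.lintegral_sum_abs_riskRatio_sub_le hn hr hK hlaw hind hz (measurable_coord a)
    (abs_coord_le a)
  -- The relation e s⁽⁰⁾ = s⁽¹⁾ makes the centres of the two laws of large numbers coincide.
  simp only [D.meanRiskRatio_mul (abs_coord_le a) hz, one_mul, ← hc] at h1 h2
  have hm1 := (D.measurable_sum_N_mul (measurable_coord a) τ (f := fun _ => 1)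
    measurable_const c).ennreal_ofReal
  have hm2 := (D.measurable_sum_N_mul measurable_one τ
    (D.measurable_meanRiskRatio (P := P) (β := β) (measurable_coord a)) c).ennreal_ofReal
  set A := √(n : ℝ) + n * (r * Real.exp (‖β‖ * K) * μ.real Set.univ) with hA
  set B := 6 * Real.exp (‖β‖ * K) * (1 + r) * √n * μ.real Set.univ with hB
  have hA0 : 0 ≤ A := by positivity
  have hB0 : 0 ≤ B := by positivity
  calc _ ≤ ∫⁻ ω, (ENNReal.ofReal |∑ i, D.N i τ ω * (D.z i ω a * 1) - c| +
        (ENNReal.ofReal |∑ i, D.N i τ ω * ((1 : EuclideanSpace ℝ (Fin m) → ℝ) (D.z i ω) *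
            D.meanRiskRatio P (fun z => z a) β (D.X i ω).toReal) - c| +
          ENNReal.ofReal (∑ i, D.N i τ ω * |D.riskRatio (fun z => z a) β (D.X i ω).toReal ω -
            D.meanRiskRatio P (fun z => z a) β (D.X i ω).toReal|))) ∂P := by
        refine lintegral_mono fun ω => ?_
        have hnn : 0 ≤ ∑ i, D.N i τ ω * |D.riskRatio (fun z => z a) β (D.X i ω).toReal ω -
            D.meanRiskRatio P (fun z => z a) β (D.X i ω).toReal| :=
          Finset.sum_nonneg fun i _ => mul_nonneg (D.N_nonneg i τ ω) (abs_nonneg _)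
        rw [← ENNReal.ofReal_add (abs_nonneg _) hnn,
          ← ENNReal.ofReal_add (abs_nonneg _) (add_nonneg (abs_nonneg _) hnn)]
        refine ENNReal.ofReal_le_ofReal ?_
        have e1 : D.score τ β ω a = (∑ i, D.N i τ ω * (D.z i ω a * 1) - c) -
            ((∑ i, D.N i τ ω * ((1 : EuclideanSpace ℝ (Fin m) → ℝ) (D.z i ω) *
              D.meanRiskRatio P (fun z => z a) β (D.X i ω).toReal) - c) +
            ∑ i, D.N i τ ω * (D.riskRatio (fun z => z a) β (D.X i ω).toReal ω -
              D.meanRiskRatio P (fun z => z a) β (D.X i ω).toReal)) := by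
          rw [score_apply]
          simp only [mul_sub, Finset.sum_sub_distrib, Pi.one_apply, one_mul, mul_one]
          ring
        rw [e1]
        refine (abs_sub _ _).trans (add_le_add_right ((abs_add_le _ _).trans
          (add_le_add_right ?_ _)) _)
        refine (Finset.abs_sum_le_sum_abs _ _).trans (le_of_eq (Finset.sum_congr rfl fun i _ => ?_))
        rw [abs_mul, abs_of_nonneg (D.N_nonneg i τ ω)]
    _ ≤ ENNReal.ofReal (K * 1 * A) + (ENNReal.ofReal (1 * K * A) + ENNReal.ofReal (K * B)) := by
        rw [lintegral_add_left hm1, lintegral_add_left hm2]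
        rw [one_mul]
        exact add_le_add h1 (add_le_add h2 h3)
    _ ≤ _ := by
        rw [← ENNReal.ofReal_add (by positivity) (by positivity),
          ← ENNReal.ofReal_add (by positivity) (by positivity)]
        refine ENNReal.ofReal_le_ofReal ?_
        rw [failureSumError, ← hA, ← hB]
        nlinarith [mul_nonneg hK.le hB0]

theorem abs_meanRiskCov_le (hK : 0 ≤ K) (hz : ∀ᵐ ω ∂P, ∀ k, ‖D.z k ω‖ ≤ K) (a b : Fin m) (u : ℝ) :
    |D.meanRiskCov P β a b u| ≤ 2 * K ^ 2 := by
  have h1 := D.abs_meanRiskRatio_le (β := β) (sq_nonneg K) (abs_coord_mul_le a b) hz u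
  have h2 := D.abs_meanRiskRatio_le (β := β) hK (abs_coord_le a) hz u
  have h3 := D.abs_meanRiskRatio_le (β := β) hK (abs_coord_le b) hz u
  refine (abs_sub _ _).trans ?_
  rw [abs_mul]
  have := mul_le_mul h2 h3 (abs_nonneg _) hK
  linarith

/-- Replace the empirical covariance at each failure by the population one, then apply the law of
large numbers to the latter, a bounded non-random function of time. -/
theorem lintegral_abs_infoEstimate_sub_le (hn : n ≠ 0) (hr : 0 ≤ r) (hK : 0 < K)
    (hlaw : D.HasFailureLaw P τ μ β r) (hind : iIndepFun D.obs P)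
    (hz : ∀ᵐ ω ∂P, ∀ k, ‖D.z k ω‖ ≤ K) (a b : Fin m) :
    ∫⁻ ω, ENNReal.ofReal |D.infoEstimate τ β a b ω -
        n * ∫ u, D.meanRiskCov P β a b u * D.meanRiskSum P 1 β u ∂μ| ∂P ≤ ENNReal.ofReal
      (3 * K ^ 2 * failureSumError (Real.exp (‖β‖ * K)) (μ.real Set.univ) r n) := by
  have hone : ∀ z : EuclideanSpace ℝ (Fin m), ‖z‖ ≤ K →
    |(1 : EuclideanSpace ℝ (Fin m) → ℝ) z| ≤ 1 := fun _ _ => (abs_one (α := ℝ)).le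
  set c := (n : ℝ) * ∫ u, D.meanRiskCov P β a b u * D.meanRiskSum P 1 β u ∂μ with hc
  have hcov : Measurable (D.meanRiskCov P β a b) :=
    (D.measurable_meanRiskRatio (measurable_coord_mul a b)).sub
      ((D.measurable_meanRiskRatio (measurable_coord a)).mul
        (D.measurable_meanRiskRatio (measurable_coord b)))
  have h1 := D.lintegral_abs_sum_N_mul_sub_le hn hr zero_le_one
    (by positivity : 0 ≤ 2 * K ^ 2) hlaw hind hz
    measurable_one hone hcov (D.abs_meanRiskCov_le hK.le hz a b)
  rw [← hc] at h1
  have h2 := D.lintegral_sum_abs_riskRatio_sub_le hn hr (pow_pos hK 2) hlaw hind hz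
    (measurable_coord_mul a b) (abs_coord_mul_le a b)
  have h3 := fun a => D.lintegral_sum_abs_riskRatio_sub_le hn hr hK hlaw hind hz (measurable_coord a)
    (abs_coord_le a)
  have hm1 := (D.measurable_sum_N_mul measurable_one τ hcov c).ennreal_ofReal
  have hm2 := (D.measurable_sum_abs_riskRatio_sub (P := P)
    (measurable_coord_mul a b) τ β).ennreal_ofReal
  have hm3 := fun a => (D.measurable_sum_abs_riskRatio_sub (P := P)
    (measurable_coord a) τ β).ennreal_ofReal
  set A := √(n : ℝ) + n * (r * Real.exp (‖β‖ * K) * μ.real Set.univ) with hA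
  set B := 6 * Real.exp (‖β‖ * K) * (1 + r) * √n * μ.real Set.univ with hB
  have hA0 : 0 ≤ A := by positivity
  have hB0 : 0 ≤ B := by positivity
  set dev : (EuclideanSpace ℝ (Fin m) → ℝ) → Ω → ℝ := fun φ ω => ∑ i, D.N i τ ω *
    |D.riskRatio φ β (D.X i ω).toReal ω - D.meanRiskRatio P φ β (D.X i ω).toReal| with hdev
  have hnn : ∀ φ ω, 0 ≤ dev φ ω := fun φ ω =>
    Finset.sum_nonneg fun i _ => mul_nonneg (D.N_nonneg i τ ω) (abs_nonneg _)
  calc _ ≤ ∫⁻ ω, (ENNReal.ofReal |∑ i, D.N i τ ω * ((1 : EuclideanSpace ℝ (Fin m) → ℝ) (D.z i ω) *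
            D.meanRiskCov P β a b (D.X i ω).toReal) - c| +
          (ENNReal.ofReal (dev (fun z => z a * z b) ω) +
            (ENNReal.ofReal K * ENNReal.ofReal (dev (fun z => z a) ω) +
              ENNReal.ofReal K * ENNReal.ofReal (dev (fun z => z b) ω)))) ∂P := by
        refine lintegral_mono_ae ?_
        filter_upwards [hz] with ω hω
        rw [← ENNReal.ofReal_mul hK.le, ← ENNReal.ofReal_mul hK.le,
          ← ENNReal.ofReal_add (mul_nonneg hK.le (hnn _ _)) (mul_nonneg hK.le (hnn _ _)),
          ← ENNReal.ofReal_add (hnn _ _) (add_nonneg (mul_nonneg hK.le (hnn _ _))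
            (mul_nonneg hK.le (hnn _ _))),
          ← ENNReal.ofReal_add (abs_nonneg _) (add_nonneg (hnn _ _)
            (add_nonneg (mul_nonneg hK.le (hnn _ _)) (mul_nonneg hK.le (hnn _ _))))]
        refine ENNReal.ofReal_le_ofReal ?_
        set V : Fin n → ℝ := fun i => D.riskRatio (fun z => z a * z b) β (D.X i ω).toReal ω -
          D.riskRatio (fun z => z a) β (D.X i ω).toReal ω *
            D.riskRatio (fun z => z b) β (D.X i ω).toReal ω with hV
        have e1 : D.infoEstimate τ β a b ω - c =
            (∑ i, D.N i τ ω * ((1 : EuclideanSpace ℝ (Fin m) → ℝ) (D.z i ω) *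
              D.meanRiskCov P β a b (D.X i ω).toReal) - c) +
            ∑ i, D.N i τ ω * (V i - D.meanRiskCov P β a b (D.X i ω).toReal) := by
          simp only [infoEstimate, hV, mul_sub, Finset.sum_sub_distrib, Pi.one_apply, one_mul]
          ring
        rw [e1]
        refine (abs_add_le _ _).trans (add_le_add_right ?_ _)
        refine (Finset.abs_sum_le_sum_abs _ _).trans ?_
        simp only [hdev, Finset.mul_sum]
        rw [← Finset.sum_add_distrib, ← Finset.sum_add_distrib]
        refine Finset.sum_le_sum fun i _ => ?_
        rw [abs_mul, abs_of_nonneg (D.N_nonneg i τ ω)]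
        set u := (D.X i ω).toReal
        have hRb := D.abs_riskRatio_le (β := β) hK.le (abs_coord_le b) hω u
        have hra := D.abs_meanRiskRatio_le (β := β) hK.le (abs_coord_le a) hz u
        have hle : |V i - D.meanRiskCov P β a b u| ≤
            |D.riskRatio (fun z => z a * z b) β u ω - D.meanRiskRatio P (fun z => z a * z b) β u| +
            (K * |D.riskRatio (fun z => z a) β u ω - D.meanRiskRatio P (fun z => z a) β u| +
             K * |D.riskRatio (fun z => z b) β u ω - D.meanRiskRatio P (fun z => z b) β u|) := by
          -- The product difference is split as pq - p'q' = q(p - p') + p'(q - q'), with |q| and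
          -- |p'| at most K. The three deviations together contribute K² + K² + K² times B.
          have e2 : V i - D.meanRiskCov P β a b u =
            (D.riskRatio (fun z => z a * z b) β u ω - D.meanRiskRatio P (fun z => z a * z b) β u) -
            (D.riskRatio (fun z => z b) β u ω *
              (D.riskRatio (fun z => z a) β u ω - D.meanRiskRatio P (fun z => z a) β u) +
             D.meanRiskRatio P (fun z => z a) β u *
              (D.riskRatio (fun z => z b) β u ω - D.meanRiskRatio P (fun z => z b) β u)) := by
            simp only [hV, meanRiskCov]
            ring
          rw [e2]
          refine (abs_sub _ _).trans (add_le_add_right ((abs_add_le _ _).trans ?_) _)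
          rw [abs_mul, abs_mul]
          gcongr
        have := mul_le_mul_of_nonneg_left hle (D.N_nonneg i τ ω)
        linarith
    _ ≤ ENNReal.ofReal (1 * (2 * K ^ 2) * A) + (ENNReal.ofReal (K ^ 2 * B) +
          (ENNReal.ofReal K * ENNReal.ofReal (K * B) +
            ENNReal.ofReal K * ENNReal.ofReal (K * B))) := by
        rw [lintegral_add_left hm1, lintegral_add_left hm2,
          lintegral_add_left ((hm3 a).const_mul _), lintegral_const_mul _ (hm3 a),
          lintegral_const_mul _ (hm3 b)]
        have h3a := h3 a
        have h3b := h3 b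
        gcongr
    _ ≤ _ := by
        rw [← ENNReal.ofReal_mul hK.le, ← ENNReal.ofReal_add (by positivity) (by positivity),
          ← ENNReal.ofReal_add (by positivity) (by positivity),
          ← ENNReal.ofReal_add (by positivity) (by positivity)]
        refine ENNReal.ofReal_le_ofReal ?_
        rw [failureSumError, ← hA, ← hB]
        nlinarith [mul_nonneg (sq_nonneg K) hA0]

/-- Identifies the centre of the estimated information, divided by n, with Σ. Boundedness of z is
what allows the vector-valued mean s⁽¹⁾ to be computed coordinatewise. -/
theorem infoMatrix_apply_eq {lam : ℝ → ℝ} (hτ : 0 ≤ τ) (hlam : ∀ t, 0 ≤ lam t)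
    (hΛ : IntervalIntegrable lam volume 0 τ) (hK : 0 ≤ K)
    (hz : ∀ᵐ ω ∂P, ∀ k, ‖D.z k ω‖ ≤ K) (a b : Fin m) :
    D.infoMatrix P lam τ β a b =
      ∫ u, D.meanRiskCov P β a b u * D.meanRiskSum P 1 β u ∂(hazardMeasure lam τ) := by
  have hs0 : ∀ u, D.s0 P u β = D.meanRiskSum P 1 β u := fun u => by
    simp only [s0, S0, meanRiskSum, riskSum, riskTerm, Pi.one_apply, mul_one]
  have hs2 : ∀ u, D.s2 P u β a b = D.meanRiskSum P (fun z => z a * z b) β u := fun u => by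
    simp only [s2, S2, Matrix.of_apply, meanRiskSum, riskSum, riskTerm]
    congr 2
    refine funext fun ω => Finset.sum_congr rfl fun k _ => by ring
  have hS1 : ∀ (a : Fin m) u ω, D.S1 u β ω a = D.riskSum (fun z => z a) β u ω := fun a u ω => by
    simp only [S1, riskSum, riskTerm, WithLp.ofLp_sum, Finset.sum_apply, PiLp.smul_apply,
      smul_eq_mul]
  have he : ∀ (a : Fin m) u, D.e P u β a = D.meanRiskRatio P (fun z => z a) β u := fun a u => by
    have hint : ∀ a, Integrable (fun ω => D.S1 u β ω a) P := fun a => by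
      simp only [hS1]
      exact D.integrable_riskSum (measurable_coord a) (abs_coord_le a) hK hz u
    have h1 : (∫ ω, D.S1 u β ω ∂P) a = ∫ ω, D.riskSum (fun z => z a) β u ω ∂P := by
      rw [eval_integral_piLp hint]
      simp only [hS1]
    simp only [e, s1, PiLp.smul_apply, smul_eq_mul, h1, hs0, meanRiskRatio, meanRiskSum,
      div_eq_inv_mul]
  have hl := (intervalIntegrable_iff_integrableOn_Ioc_of_le hτ).1 hΛ
  rw [hazardMeasure, integral_withDensity_eq_integral_toReal_smul₀ hl.aemeasurable.ennreal_ofReal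
    (Eventually.of_forall fun _ => ENNReal.ofReal_lt_top), infoMatrix, Matrix.of_apply,
    intervalIntegral.integral_of_le hτ]
  refine integral_congr_ae (Eventually.of_forall fun u => ?_)
  simp only [v, Matrix.of_apply, hs0, hs2, he, ENNReal.toReal_ofReal (hlam u), smul_eq_mul,
    meanRiskCov, meanRiskRatio]
  ring

end SurvivalSample

/-! ### Quadratic forms, the error rate and Markov's inequality -/

theorem Matrix.PosDef.exists_pos_mul_norm_sq_le {m : ℕ} (j : Fin m)
    {A : Matrix (Fin m) (Fin m) ℝ} (hA : A.PosDef) :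
    ∃ α : ℝ, 0 < α ∧ ∀ h : EuclideanSpace ℝ (Fin m),
      α * ‖h‖ ^ 2 ≤ ∑ a, ∑ b, h a * h b * A a b := by
  have hq : ∀ x : Fin m → ℝ, star x ⬝ᵥ A.mulVec x = ∑ a, ∑ b, x a * x b * A a b := fun x => by
    simp only [dotProduct, Matrix.mulVec, Finset.mul_sum, star_trivial]
    exact Finset.sum_congr rfl fun a _ => Finset.sum_congr rfl fun b _ => by ring
  have hcont : Continuous fun h : EuclideanSpace ℝ (Fin m) => ∑ a, ∑ b, h a * h b * A a b := by
    fun_prop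
  -- The index j witnesses m ≥ 1, without which the unit sphere would be empty.
  have hne : (Metric.sphere (0 : EuclideanSpace ℝ (Fin m)) 1).Nonempty :=
    ⟨EuclideanSpace.single j 1, by simp⟩
  obtain ⟨x, hx, hmin⟩ := (isCompact_sphere (0 : EuclideanSpace ℝ (Fin m)) 1).exists_isMinOn hne
    hcont.continuousOn
  have hx1 : ‖x‖ = 1 := by simpa using hx
  have hx0 : (x : Fin m → ℝ) ≠ 0 := fun h0 => by
    have h1 : x = 0 := by ext a; exact congrFun h0 a
    rw [h1, norm_zero] at hx1
    exact zero_ne_one hx1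
  refine ⟨∑ a, ∑ b, x a * x b * A a b, by rw [← hq]; exact hA.dotProduct_mulVec_pos hx0,
    fun h => ?_⟩
  rcases eq_or_ne h 0 with rfl | hh
  · simp
  have hpos : 0 < ‖h‖ := norm_pos_iff.2 hh
  have hmem : (‖h‖⁻¹ • h) ∈ Metric.sphere (0 : EuclideanSpace ℝ (Fin m)) 1 := by
    simp [norm_smul, hpos.ne']
  have h1 := isMinOn_iff.1 hmin _ hmem
  have h2 : ∑ a, ∑ b, (‖h‖⁻¹ • h) a * (‖h‖⁻¹ • h) b * A a b =
      (‖h‖ ^ 2)⁻¹ * ∑ a, ∑ b, h a * h b * A a b := by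
    simp only [Finset.mul_sum, PiLp.smul_apply, smul_eq_mul]
    exact Finset.sum_congr rfl fun a _ => Finset.sum_congr rfl fun b _ => by field_simp
  rw [h2, inv_mul_eq_div, le_div_iff₀ (by positivity)] at h1
  exact h1

theorem norm_le_card_mul_of_abs_le {m : ℕ} {x : EuclideanSpace ℝ (Fin m)} {t : ℝ} (ht : 0 ≤ t)
    (hx : ∀ a, |x a| ≤ t) : ‖x‖ ≤ m * t := by
  rcases Nat.eq_zero_or_pos m with rfl | hm
  · simp [Subsingleton.elim x 0]
  refine abs_le_of_sq_le_sq' ?_ (by positivity) |>.2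
  rw [EuclideanSpace.real_norm_sq_eq]
  calc ∑ a, x a ^ 2 ≤ ∑ _a : Fin m, t ^ 2 :=
        Finset.sum_le_sum fun a _ => by
          rw [← sq_abs]; exact pow_le_pow_left₀ (abs_nonneg _) (hx a) 2
    _ = m * t ^ 2 := by simp
    _ ≤ (m * t) ^ 2 := by
        have h1 : (1 : ℝ) ≤ m := by exact_mod_cast hm
        nlinarith [mul_nonneg (sub_nonneg.2 h1) (mul_nonneg (Nat.cast_nonneg (α := ℝ) m) (sq_nonneg t))]

/-- Cauchy–Schwarz gives (∑ |h_a|)² ≤ m ‖h‖²; this converts entrywise errors of a matrix into an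
error of its quadratic form. -/
theorem abs_sum_sum_mul_mul_le {m : ℕ} (h : EuclideanSpace ℝ (Fin m)) {B : Fin m → Fin m → ℝ}
    {t : ℝ} (ht : 0 ≤ t) (hB : ∀ a b, |B a b| ≤ t) :
    |∑ a, ∑ b, h a * h b * B a b| ≤ m * t * ‖h‖ ^ 2 := by
  have h1 : |∑ a, ∑ b, h a * h b * B a b| ≤ ∑ a, ∑ b, (|h a| * |h b|) * t := by
    refine (Finset.abs_sum_le_sum_abs _ _).trans (Finset.sum_le_sum fun a _ => ?_)
    refine (Finset.abs_sum_le_sum_abs _ _).trans (Finset.sum_le_sum fun b _ => ?_)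
    rw [abs_mul, abs_mul]
    exact mul_le_mul_of_nonneg_left (hB a b) (by positivity)
  have h2 : ∑ a, ∑ b, (|h a| * |h b|) * t = (∑ a, |h a|) ^ 2 * t := by
    rw [pow_two, Finset.sum_mul_sum, Finset.sum_mul]
    exact Finset.sum_congr rfl fun a _ => (Finset.sum_mul _ _ _).symm
  have h3 : (∑ a, |h a|) ^ 2 ≤ m * ‖h‖ ^ 2 := by
    have := sq_sum_le_card_mul_sum_sq (s := Finset.univ) (f := fun a : Fin m => |h a|)
    simpa [EuclideanSpace.real_norm_sq_eq] using this
  calc _ ≤ _ := h1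
    _ = _ := h2
    _ ≤ m * ‖h‖ ^ 2 * t := mul_le_mul_of_nonneg_right h3 ht
    _ = _ := by ring

/-- The fluctuation terms are of order √n and the bias term is n r, so everything is o(n) once r →
0. -/
theorem tendsto_failureSumError_div (W L : ℝ) {r : ℕ → ℝ} (hr : Tendsto r atTop (𝓝 0)) :
    Tendsto (fun n => failureSumError W L (r n) n / n) atTop (𝓝 0) := by
  have hs : Tendsto (fun n : ℕ => (√(n : ℝ))⁻¹) atTop (𝓝 0) :=
    tendsto_inv_atTop_zero.comp (Real.tendsto_sqrt_atTop.comp tendsto_natCast_atTop_atTop)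
  have h1 : Tendsto (fun n : ℕ => (√(n : ℝ))⁻¹ + r n * W * L +
      6 * W * (1 + r n) * (√(n : ℝ))⁻¹ * L) atTop
      (𝓝 (0 + 0 * W * L + 6 * W * (1 + 0) * 0 * L)) :=
    (hs.add ((hr.mul_const W).mul_const L)).add
      ((((hr.const_add 1).const_mul (6 * W)).mul hs).mul_const L)
  have h2 : (0 : ℝ) + 0 * W * L + 6 * W * (1 + 0) * 0 * L = 0 := by ring
  rw [h2] at h1
  refine h1.congr' ?_
  filter_upwards [eventually_gt_atTop 0] with n hn
  have hn' : (0 : ℝ) < n := by exact_mod_cast hn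
  have hsq : √(n : ℝ) * √(n : ℝ) = n := Real.mul_self_sqrt hn'.le
  have hs' : 0 < √(n : ℝ) := Real.sqrt_pos.2 hn'
  have hinv : (√(n : ℝ))⁻¹ = √(n : ℝ) / n := by
    rw [inv_eq_one_div, div_eq_div_iff hs'.ne' hn'.ne', one_mul, hsq]
  rw [failureSumError, hinv]
  field_simp

theorem measure_le_of_lintegral_abs_le {Ω : Type*} [MeasurableSpace Ω] {P : Measure Ω}
    {f : Ω → ℝ} (hf : Measurable f) {t c : ℝ} (ht : 0 < t)
    (h : ∫⁻ ω, ENNReal.ofReal |f ω| ∂P ≤ ENNReal.ofReal c) :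
    P {ω | t ≤ |f ω|} ≤ ENNReal.ofReal (c / t) := by
  have h1 := meas_ge_le_lintegral_div (μ := P) hf.abs.ennreal_ofReal.aemeasurable
    (ε := ENNReal.ofReal t) (by simpa using ht) ENNReal.ofReal_ne_top
  refine (measure_mono fun ω hω => ?_).trans (h1.trans ?_)
  · exact ENNReal.ofReal_le_ofReal hω
  · rw [ENNReal.ofReal_div_of_pos ht]
    exact ENNReal.div_le_div_right h _

/-! ### From small errors to a unique root near the true parameter -/

namespace SurvivalSample

variable {m n : ℕ} {Ω : Type*} [mΩ : MeasurableSpace Ω] (D : SurvivalSample m n Ω)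

/-- A unit belongs to its own risk set when it fails, so no event term of the score has denominator
0. -/
theorem Y_failureTime_pos {i : Fin n} {τ : ℝ} {ω : Ω} (h : D.N i τ ω ≠ 0) :
    0 < D.Y i (D.X i ω).toReal ω := by
  have hmem : ω ∈ D.failureEvent i τ := by
    by_contra hc
    exact h (by rw [N_eq_indicator, Set.indicator_of_notMem hc])
  have hX : D.X i ω ≠ ∞ := ne_top_of_le_ne_top ENNReal.ofReal_ne_top hmem.1
  have : D.Y i (D.X i ω).toReal ω = 1 := Set.indicator_of_mem
    (s := {ω' | ENNReal.ofReal (D.X i ω).toReal ≤ D.X i ω'})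
    (show ENNReal.ofReal (D.X i ω).toReal ≤ D.X i ω from (ENNReal.ofReal_toReal hX).le) _
  rw [this]
  exact one_pos

/-- Link between the two halves: the information of the tilting argument is the quadratic form of
the estimated information matrix. -/
theorem sum_N_mul_tiltedVariance (τ : ℝ) (β h : EuclideanSpace ℝ (Fin m)) (ω : Ω) :
    ∑ i, D.N i τ ω * tiltedVariance (fun k => D.Y k (D.X i ω).toReal ω) (fun k => D.z k ω) β h =
      ∑ a, ∑ b, h a * h b * D.infoEstimate τ β a b ω := by
  have hmass : ∀ u, tiltedMass (fun k => D.Y k u ω) (fun k => D.z k ω) β = D.riskSum 1 β u ω :=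
    fun u => by simp only [tiltedMass, riskSum, riskTerm, Pi.one_apply, mul_one]
  have hin : ∀ z : EuclideanSpace ℝ (Fin m), inner ℝ h z = ∑ a, h a * z a := fun z => by
    rw [PiLp.inner_apply]
    exact Finset.sum_congr rfl fun a _ => by simp [mul_comm]
  have hvar : ∀ u, tiltedVariance (fun k => D.Y k u ω) (fun k => D.z k ω) β h =
      ∑ a, ∑ b, h a * h b * (D.riskRatio (fun z => z a * z b) β u ω -
        D.riskRatio (fun z => z a) β u ω * D.riskRatio (fun z => z b) β u ω) := fun u => by
    have h1 : ∑ k, D.Y k u ω * Real.exp (inner ℝ β (D.z k ω)) * inner ℝ h (D.z k ω) =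
        ∑ a, h a * D.riskSum (fun z => z a) β u ω := by
      simp only [riskSum, riskTerm, hin, Finset.mul_sum]
      rw [Finset.sum_comm]
      exact Finset.sum_congr rfl fun a _ => Finset.sum_congr rfl fun k _ => by ring
    have h2 : ∑ k, D.Y k u ω * Real.exp (inner ℝ β (D.z k ω)) * inner ℝ h (D.z k ω) ^ 2 =
        ∑ a, ∑ b, h a * h b * D.riskSum (fun z => z a * z b) β u ω := by
      have hsq : ∀ z : EuclideanSpace ℝ (Fin m),
          inner ℝ h z ^ 2 = ∑ a, ∑ b, h a * h b * (z a * z b) := fun z => by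
        rw [hin, pow_two, Finset.sum_mul_sum]
        exact Finset.sum_congr rfl fun a _ => Finset.sum_congr rfl fun b _ => by ring
      simp only [riskSum, riskTerm, hsq, Finset.mul_sum]
      rw [Finset.sum_comm]
      refine Finset.sum_congr rfl fun a _ => ?_
      rw [Finset.sum_comm]
      exact Finset.sum_congr rfl fun b _ => Finset.sum_congr rfl fun k _ => by ring
    rw [tiltedVariance, inner_tiltedMean, hmass, h1, h2]
    simp only [mul_sub, Finset.sum_sub_distrib]
    congr 1
    · simp only [Finset.sum_div, riskRatio, mul_div_assoc]
    · simp only [Finset.sum_div, pow_two, Finset.sum_mul_sum, riskRatio]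
      exact Finset.sum_congr rfl fun a _ => Finset.sum_congr rfl fun b _ => by ring
  simp only [hvar, infoEstimate, Finset.mul_sum]
  rw [Finset.sum_comm]
  refine Finset.sum_congr rfl fun a _ => ?_
  rw [Finset.sum_comm]
  exact Finset.sum_congr rfl fun b _ => Finset.sum_congr rfl fun k _ => by ring

/-- If the score at `β` is small and the estimated information is close to a matrix bounded below,
then the score equation has a unique solution, and the solution is close to `β`. -/
theorem exists_unique_score_eq_zero {K τ ε α η : ℝ} {β : EuclideanSpace ℝ (Fin m)} {ω : Ω}
    (hn : n ≠ 0) (hz : ∀ k, ‖D.z k ω‖ ≤ K) (hε : 0 < ε) (hα : 0 < α) (hη : 0 ≤ η)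
    (hη1 : m * η ≤ α / 2) (hη2 : m * η < Real.exp (-(2 * (ε * K))) * (α / 2 * ε))
    {S : Fin m → Fin m → ℝ}
    (hS : ∀ h : EuclideanSpace ℝ (Fin m), α * ‖h‖ ^ 2 ≤ ∑ a, ∑ b, h a * h b * S a b)
    (hscore : ∀ a, |D.score τ β ω a| ≤ η * n)
    (hinfo : ∀ a b, |D.infoEstimate τ β a b ω - n * S a b| ≤ η * n) :
    ∃ β', ‖β' - β‖ < ε ∧ D.score τ β' ω = 0 ∧ ∀ β'', D.score τ β'' ω = 0 → β'' = β' := by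
  have hnpos : (0 : ℝ) < n := by exact_mod_cast Nat.pos_of_ne_zero hn
  have hsc : ∀ β', D.score τ β' ω = tiltedScore (fun i => D.N i τ ω)
      (fun i k => D.Y k (D.X i ω).toReal ω) (fun k => D.z k ω) β' := fun β' => rfl
  simp only [hsc]
  -- Of the lower bound α n, the estimation error consumes at most m η n ≤ (α/2) n.
  refine exists_unique_tiltedScore_eq_zero (K := K) (a := α / 2 * n) (fun i => D.N_nonneg i τ ω)
    (fun i k => D.Y_nonneg k _ ω) (fun i hi => ⟨i, D.Y_failureTime_pos hi⟩) hz hε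
    (by positivity) (fun h => ?_) ?_
  · rw [D.sum_N_mul_tiltedVariance]
    have h1 := neg_le_of_abs_le (abs_sum_sum_mul_mul_le h (mul_nonneg hη hnpos.le) hinfo)
    have h2 : ∑ a, ∑ b, h a * h b * (D.infoEstimate τ β a b ω - n * S a b) =
        ∑ a, ∑ b, h a * h b * D.infoEstimate τ β a b ω -
          n * ∑ a, ∑ b, h a * h b * S a b := by
      simp only [mul_sub, Finset.sum_sub_distrib, Finset.mul_sum]
      congr 1
      exact Finset.sum_congr rfl fun a _ => Finset.sum_congr rfl fun b _ => by ring
    rw [h2] at h1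
    have h3 := mul_le_mul_of_nonneg_left (hS h) hnpos.le
    have h4 := mul_le_mul_of_nonneg_right hη1 (mul_nonneg hnpos.le (sq_nonneg ‖h‖))
    nlinarith
  · rw [← hsc]
    refine (norm_le_card_mul_of_abs_le (mul_nonneg hη hnpos.le) hscore).trans_lt ?_
    have := mul_lt_mul_of_pos_right hη2 hnpos
    linarith

/-- A bound on the probability that the score equation fails to have a unique solution near `β`. -/
theorem measure_not_exists_unique_score_eq_zero_le {P : Measure Ω} [IsProbabilityMeasure P]
    {K τ ε α η r : ℝ} {β : EuclideanSpace ℝ (Fin m)} {μ : Measure ℝ} [IsFiniteMeasure μ]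
    (hn : n ≠ 0) (hz : ∀ᵐ ω ∂P, ∀ k, ‖D.z k ω‖ ≤ K) (hr : 0 ≤ r) (hK : 0 < K)
    (hlaw : D.HasFailureLaw P τ μ β r) (hind : iIndepFun D.obs P)
    (hε : 0 < ε) (hα : 0 < α) (hη : 0 < η)
    (hη1 : m * η ≤ α / 2) (hη2 : m * η < Real.exp (-(2 * (ε * K))) * (α / 2 * ε))
    (hS : ∀ h : EuclideanSpace ℝ (Fin m), α * ‖h‖ ^ 2 ≤
      ∑ a, ∑ b, h a * h b * ∫ u, D.meanRiskCov P β a b u * D.meanRiskSum P 1 β u ∂μ) :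
    P {ω | ¬ ∃ β', ‖β' - β‖ < ε ∧ D.score τ β' ω = 0 ∧ ∀ β'', D.score τ β'' ω = 0 → β'' = β'} ≤
      ENNReal.ofReal ((m * (2 * K) + m * m * (3 * K ^ 2)) / η *
        (failureSumError (Real.exp (‖β‖ * K)) (μ.real Set.univ) r n / n)) := by
  have hnpos : (0 : ℝ) < n := by exact_mod_cast Nat.pos_of_ne_zero hn
  have ht : 0 < η * n := mul_pos hη hnpos
  set ρ := failureSumError (Real.exp (‖β‖ * K)) (μ.real Set.univ) r n with hρ
  have hρ0 : 0 ≤ ρ := by rw [hρ, failureSumError]; positivity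
  set S : Fin m → Fin m → ℝ := fun a b =>
    ∫ u, D.meanRiskCov P β a b u * D.meanRiskSum P 1 β u ∂μ with hSdef
  have h1 : ∀ a, P {ω | η * n ≤ |D.score τ β ω a|} ≤ ENNReal.ofReal (2 * K * ρ / (η * n)) :=
    fun a => measure_le_of_lintegral_abs_le (D.measurable_score_apply τ β a) ht
      (D.lintegral_abs_score_le hn hr hK hlaw hind hz a)
  have h2 : ∀ a b, P {ω | η * n ≤ |D.infoEstimate τ β a b ω - n * S a b|} ≤
      ENNReal.ofReal (3 * K ^ 2 * ρ / (η * n)) :=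
    fun a b => measure_le_of_lintegral_abs_le ((D.measurable_infoEstimate τ β a b).sub_const _) ht
      (D.lintegral_abs_infoEstimate_sub_le hn hr hK hlaw hind hz a b)
  -- Failure requires one of m score coordinates or m² information entries to be off by η n, apart
  -- from the null event of large covariates.
  have hsub : {ω | ¬ ∃ β', ‖β' - β‖ < ε ∧ D.score τ β' ω = 0 ∧
      ∀ β'', D.score τ β'' ω = 0 → β'' = β'} ⊆
      {ω | ¬ ∀ k, ‖D.z k ω‖ ≤ K} ∪ ((⋃ a, {ω | η * n ≤ |D.score τ β ω a|}) ∪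
        ⋃ a, ⋃ b, {ω | η * n ≤ |D.infoEstimate τ β a b ω - n * S a b|}) := by
    intro ω hω
    by_contra hc
    simp only [Set.mem_union, Set.mem_iUnion, Set.mem_ofPred_eq, not_or, not_not, not_exists,
      not_le] at hc
    exact hω (D.exists_unique_score_eq_zero hn hc.1 hε hα hη.le hη1 hη2 hS
      (fun a => (hc.2.1 a).le) fun a b => (hc.2.2 a b).le)
  calc _ ≤ P {ω | ¬ ∀ k, ‖D.z k ω‖ ≤ K} + (P (⋃ a, {ω | η * n ≤ |D.score τ β ω a|}) +
        P (⋃ a, ⋃ b, {ω | η * n ≤ |D.infoEstimate τ β a b ω - n * S a b|})) :=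
        (measure_mono hsub).trans ((measure_union_le _ _).trans
          (add_le_add_right (measure_union_le _ _) _))
    _ ≤ 0 + (∑ _a : Fin m, ENNReal.ofReal (2 * K * ρ / (η * n)) +
        ∑ _a : Fin m, ∑ _b : Fin m, ENNReal.ofReal (3 * K ^ 2 * ρ / (η * n))) := by
        refine add_le_add (le_of_eq (ae_iff.1 hz)) (add_le_add ?_ ?_)
        · exact (measure_iUnion_fintype_le _ _).trans (Finset.sum_le_sum fun a _ => h1 a)
        · exact (measure_iUnion_fintype_le _ _).trans (Finset.sum_le_sum fun a _ =>
            (measure_iUnion_fintype_le _ _).trans (Finset.sum_le_sum fun b _ => h2 a b))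
    _ = _ := by
        rw [zero_add, ← ENNReal.ofReal_sum_of_nonneg fun _ _ => by positivity]
        simp only [← ENNReal.ofReal_sum_of_nonneg
          (s := (Finset.univ : Finset (Fin m))) (f := fun _ => 3 * K ^ 2 * ρ / (η * n))
          fun _ _ => by positivity]
        rw [← ENNReal.ofReal_sum_of_nonneg fun _ _ => by positivity,
          ← ENNReal.ofReal_add (by positivity) (by positivity)]
        congr 1
        simp only [Finset.sum_const, Finset.card_univ, Fintype.card_fin, nsmul_eq_mul]
        field_simp

end SurvivalSample

/-! ### Conclusion: existence, uniqueness and consistency -/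

theorem theorem2 {m : ℕ} (j : Fin m) (β₀ : EuclideanSpace ℝ (Fin m)) (c : ℝ)
    (lam : ℝ → ℝ) (τ : ℝ)
    -- for each `n`, a sample of `n` units on its own probability space
    (Ω : ℕ → Type*) [∀ n, MeasurableSpace (Ω n)]
    (P : ∀ n, Measure (Ω n)) [∀ n, IsProbabilityMeasure (P n)]
    (D : ∀ n, SurvivalSample m n (Ω n))
    (hlam : ∀ t, 0 ≤ lam t)
    -- the alternative model with true value `β₀` and `γ_j = c / √n`
    (hhazard : ∀ n, (D n).HasHazard (P n) τ (hazardRate lam j β₀ (c / √(n : ℝ))))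
    (hintensity : ∀ n, (D n).HasIntensity (P n) τ (hazardRate lam j β₀ (c / √(n : ℝ))))
    -- a) i.i.d. observations
    (hiid : ∀ n, (D n).IsIID (P n))
    -- b) `sup {t : Y(t) > 0} → τ > 0` in probability
    (hτ : 0 < τ)
    (hlast : ∀ ε : ℝ, 0 < ε → Tendsto
      (fun n => P n {ω | ENNReal.ofReal ε ≤ edist ((D n).lastAtRisk ω) (ENNReal.ofReal τ)})
      atTop (𝓝 0))
    -- c) bounded covariates
    (hz : ∃ K : ℝ, 0 < K ∧ ∀ n i, ∀ᵐ ω ∂(P n), ‖(D n).z i ω‖ ≤ K)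
    -- d) `Λ(τ) < ∞`
    (hΛ : IntervalIntegrable lam volume 0 τ)
    -- e) the matrices `Σ(β₀)` are positive definite, without degenerating as `n → ∞`
    (hinfo : ∃ A : Matrix (Fin m) (Fin m) ℝ, A.PosDef ∧
      ∀ᶠ n in atTop, ((D n).infoMatrix (P n) lam τ β₀ - A).PosSemidef) :
    Tendsto (fun n => P n {ω | ∃! β, (D n).score τ β ω = 0}) atTop (𝓝 1) ∧
    ∀ βhat : ∀ n, Ω n → EuclideanSpace ℝ (Fin m),
      (∀ n, ∀ᵐ ω ∂(P n), (∃! β, (D n).score τ β ω = 0) → (D n).score τ (βhat n ω) ω = 0) →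
      ∀ ε : ℝ, 0 < ε → Tendsto (fun n => P n {ω | ε ≤ ‖βhat n ω - β₀‖}) atTop (𝓝 0) := by

  obtain ⟨K, hK, hzK⟩ := hz
  obtain ⟨A, hA, hAinfo⟩ := hinfo
  obtain ⟨α, hα, hAα⟩ := hA.exists_pos_mul_norm_sq_le j
  have hzall : ∀ n, ∀ᵐ ω ∂P n, ∀ k, ‖(D n).z k ω‖ ≤ K := fun n => ae_all_iff.2 (hzK n)
  have := isFiniteMeasure_hazardMeasure hτ.le hΛ
  set r : ℕ → ℝ := fun n => Real.exp (|c / √(n : ℝ)| * K) - 1 with hr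
  have hr0 : ∀ n, 0 ≤ r n := fun n =>
    sub_nonneg.2 (Real.one_le_exp (mul_nonneg (abs_nonneg _) hK.le))
  have hrlim : Tendsto r atTop (𝓝 0) := by
    have h1 : Tendsto (fun n : ℕ => c / √(n : ℝ)) atTop (𝓝 0) :=
      (Real.tendsto_sqrt_atTop.comp tendsto_natCast_atTop_atTop).const_div_atTop c
    have h2 := (h1.abs.mul_const K).rexp.sub_const 1
    simpa using h2
  have hlaw : ∀ n, (D n).HasFailureLaw (P n) τ (hazardMeasure lam τ) β₀ (r n) := fun n =>
    (D n).hasFailureLaw_of_hasIntensity hτ hlam hΛ (hhazard n) (hintensity n) (hzall n)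
  have hbad : ∀ ε : ℝ, 0 < ε → Tendsto (fun n => P n {ω | ¬ ∃ β, ‖β - β₀‖ < ε ∧
      (D n).score τ β ω = 0 ∧ ∀ β', (D n).score τ β' ω = 0 → β' = β}) atTop (𝓝 0) := by
    intro ε hε
    -- Chosen so that a single η meets both requirements, for the information and for the score; the
    -- denominator m + 1 makes m η < (α/2) κ strict.
    set κ := min 1 (Real.exp (-(2 * (ε * K))) * ε) with hκ
    have hκpos : 0 < κ := lt_min one_pos (by positivity)
    set η := α / 2 * κ / (m + 1) with hηdef
    have hη : 0 < η := by positivity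
    have hmη : m * η < α / 2 * κ := by
      have h1 : η * (m + 1) = α / 2 * κ := by rw [hηdef]; field_simp
      linarith
    have hη1 : m * η ≤ α / 2 :=
      hmη.le.trans (mul_le_of_le_one_right (by positivity) (min_le_left _ _))
    have hη2 : m * η < Real.exp (-(2 * (ε * K))) * (α / 2 * ε) := by
      have := mul_le_mul_of_nonneg_left (min_le_right 1 (Real.exp (-(2 * (ε * K))) * ε))
        (by positivity : 0 ≤ α / 2)
      rw [← hκ] at this
      linarith
    have hlim := (tendsto_failureSumError_div (Real.exp (‖β₀‖ * K))
      ((hazardMeasure lam τ).real Set.univ) hrlim).const_mul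
        ((m * (2 * K) + m * m * (3 * K ^ 2)) / η)
    rw [mul_zero] at hlim
    have hlim' := ENNReal.tendsto_ofReal hlim
    rw [ENNReal.ofReal_zero] at hlim'
    refine tendsto_of_tendsto_of_tendsto_of_le_of_le' tendsto_const_nhds hlim'
      (Eventually.of_forall fun n => zero_le) ?_
    filter_upwards [hAinfo, eventually_ne_atTop 0] with n hAn hn
    refine (D n).measure_not_exists_unique_score_eq_zero_le hn (hzall n) (hr0 n) hK (hlaw n)
      (hiid n).1 hε hα hη hη1 hη2 fun h => (hAα h).trans ?_
    simp only [← (D n).infoMatrix_apply_eq hτ.le hlam hΛ hK.le (hzall n)]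
    -- Since Σ - A is positive semidefinite, the constant α of the fixed matrix A serves for all
    -- large n.
    have h1 := hAn.dotProduct_mulVec_nonneg h
    have h2 : star (h : Fin m → ℝ) ⬝ᵥ ((D n).infoMatrix (P n) lam τ β₀ - A).mulVec h =
        ∑ a, ∑ b, h a * h b * (D n).infoMatrix (P n) lam τ β₀ a b -
          ∑ a, ∑ b, h a * h b * A a b := by
      simp only [dotProduct, Matrix.mulVec, Finset.mul_sum, star_trivial, Matrix.sub_apply]
      rw [← Finset.sum_sub_distrib]
      refine Finset.sum_congr rfl fun a _ => ?_
      rw [← Finset.sum_sub_distrib]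
      exact Finset.sum_congr rfl fun b _ => by ring
    rw [h2] at h1
    linarith
  refine ⟨?_, fun βhat hβhat ε hε => ?_⟩
  -- Any radius would do here. Subadditivity gives 1 ≤ P(good) + P(bad), so measurability of the two
  -- events is not required.
  · have h1 := ENNReal.Tendsto.sub (tendsto_const_nhds (x := (1 : ℝ≥0∞)) (f := atTop))
      (hbad 1 one_pos) (Or.inl ENNReal.one_ne_top)
    rw [tsub_zero] at h1
    refine tendsto_of_tendsto_of_tendsto_of_le_of_le h1 tendsto_const_nhds (fun n => ?_)
      fun n => prob_le_one
    refine tsub_le_iff_right.2 ?_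
    rw [← measure_univ (μ := P n)]
    refine (measure_mono fun ω _ => ?_).trans (measure_union_le _ _)
    by_cases h : ∃ β, ‖β - β₀‖ < 1 ∧
      (D n).score τ β ω = 0 ∧ ∀ β', (D n).score τ β' ω = 0 → β' = β
    · obtain ⟨β, -, h0, huniq⟩ := h
      exact Or.inl ⟨β, h0, huniq⟩
    · exact Or.inr h
  · refine tendsto_of_tendsto_of_tendsto_of_le_of_le tendsto_const_nhds (hbad ε hε)
      (fun n => zero_le) fun n => ?_
    -- Off the bad event and a null set, the estimator is the unique root, which lies within ε of
    -- `β₀`.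
    have hsub : {ω | ε ≤ ‖βhat n ω - β₀‖} ⊆ {ω | ¬ ∃ β, ‖β - β₀‖ < ε ∧
        (D n).score τ β ω = 0 ∧ ∀ β', (D n).score τ β' ω = 0 → β' = β} ∪
        {ω | ¬ ((∃! β, (D n).score τ β ω = 0) → (D n).score τ (βhat n ω) ω = 0)} := by
      intro ω hω
      by_contra hc
      simp only [Set.mem_union, Set.mem_ofPred_eq, not_or, not_not] at hc
      obtain ⟨⟨β, hβ, h0, huniq⟩, himp⟩ := hc
      have h1 : βhat n ω = β := huniq _ (himp ⟨β, h0, huniq⟩)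
      have h2 : ε ≤ ‖βhat n ω - β₀‖ := hω
      rw [h1] at h2
      exact absurd hβ (not_lt.2 h2)
    refine (measure_mono hsub).trans ((measure_union_le _ _).trans (le_of_eq ?_))
    rw [ae_iff.1 (hβhat n), add_zero]
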